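/- Let $\Lambda_0$ be the space of all $u\in L^2(\mathbb R^2)$ of the form $u(x_1,x_2)=f(z)e^{-\pi|z|^2/2}$, $z=x_1+ix_2$, with $f:\mathbb C\to\mathbb C$ entire. For $\varepsilon,\kappa,g_0>0$ put $$E(u)=\int_{\mathbb R^2}\Bigl(\tfrac12(\varepsilon^2x_1^2+\kappa^2x_2^2)|u|^2+\tfrac{g_0}{2}|u|^4\Bigr)dx,\qquad I(\varepsilon,\kappa)=\inf\{E(u):u\in\Lambda_0,\ \|u\|_{L^2(\mathbb R^2)}=1\},$$ and $$J=J(g_0)=\inf\Bigl\{\int_{\mathbb R}\Bigl(\tfrac12t^2p(t)^2+\tfrac{g_0}{2}p(t)^4\Bigr)dt:\ p\in L^2(\mathbb R)\cap L^4(\mathbb R)\text{ real-valued},\ \|p\|_{L^2(\mathbb R)}=1\Bigr\}.$$ By a minimizer of $I(\varepsilon,\kappa)$ or of $J$ we mean an admissible function at which the infimum is attained. (i) For every $g_0>0$, $J$ has a nonnegative minimizer $p$, and every minimizer $q$ of $J$ satisfies $|q|=p$ almost everywhere. (ii) Fix $g_0>0$ and $K>0$. As $(\varepsilon,\varepsilon^{1/3}\kappa^{-1})\to(0,0)$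 with $\varepsilon>0$ and $0<\kappa\le K$, $$\frac{I(\varepsilon,\kappa)-\frac{\kappa^2}{8\pi}}{\varepsilon^{2/3}}\longrightarrow J .$$ In addition, if $u$ is any minimizer of $I(\varepsilon,\kappa)$ and $p$ is the nonnegative minimizer of $J$, then in the same limit, uniformly in the choice of $u$, $$\frac1{\varepsilon^{1/3}}\Bigl|u\Bigl(\frac{x_1}{\varepsilon^{2/3}},x_2\Bigr)\Bigr|\longrightarrow 2^{1/4}e^{-\pi x_2^2}p(x_1)\quad\text{in }L^2(\mathbb R^2)\cap L^4(\mathbb R^2).$$ (iii) The same holds for the physical values of $\kappa$ and $g_0$: fix $g>0$ and $\omega_0>0$, let $\omega\ge\omega_0$ and $\nu,\varepsilon>0$ with $\omega^2+\nu^2+\varepsilon^2=1$, and put $\alpha=\sqrt{\nu^4+4\omega^2}$, $\mu_2^2=1+\omega^2+\alpha$ with $\mu_2>0$, $$\beta_2=\frac{2\omega\mu_2}{\alpha+2\omega^2+\nu^2},\quad \gamma=\frac{2\alpha}{\omega},\quad \kappa_1^2=(2\nu^2+\varepsilon^2)\Bigl(1+\frac{2\nu^2}{\alpha-\nu^2+2\omega^2}\Bigr)\text{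 with }\kappa_1>0,\quad g_1=g\,\frac{\alpha+2\omega^2+\nu^2}{2\alpha},$$ $\kappa=\kappa_1/\beta_2$ and $g_0=g_1\gamma^2/(4\beta_2)$. Then, as $(\varepsilon,\varepsilon^{1/3}\kappa^{-1})\to(0,0)$ under these constraints, $$\frac{I(\varepsilon,\kappa)-\frac{\kappa^2}{8\pi}}{\varepsilon^{2/3}}-J(g_0)\longrightarrow0,$$ and, uniformly over all minimizers $u$ of $I(\varepsilon,\kappa)$, $\varepsilon^{-1/3}|u(x_1/\varepsilon^{2/3},x_2)|-2^{1/4}e^{-\pi x_2^2}p(x_1)\to0$ in $L^2(\mathbb R^2)\cap L^4(\mathbb R^2)$, where $p$ is the nonnegative minimizer of $J(g_0)$. -/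

import Mathlib

open MeasureTheory Filter Topology
open scoped ENNReal

namespace AnisotropicBEC

noncomputable section

/-! ### The lowest Landau level problem -/

/-- The space `Λ₀` of square integrable functions on `ℝ²` of the form
`f(z) exp(-π|z|²/2)`, `z = x₁ + i x₂`, with `f` entire. Every class in `L²` that contains
such a function contains exactly one of them, so we work with these (continuous) functions. -/
def Lambda0 : Set (ℝ × ℝ → ℂ) :=
  {u | MemLp u 2 volume ∧ ∃ f : ℂ → ℂ, Differentiable ℂ f ∧
    ∀ x : ℝ × ℝ, u x = f (x.1 + x.2 * Complex.I) *
      (Real.exp (-(Real.pi * (x.1 ^ 2 + x.2 ^ 2) / 2)) : ℂ)}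

/-- The energy `E(u) = ∫ ½ (ε² x₁² + κ² x₂²) |u|² + (g₀/2) |u|⁴`, with values in `[0, ∞]`. -/
def energy (ε κ g₀ : ℝ) (u : ℝ × ℝ → ℂ) : ℝ≥0∞ :=
  ∫⁻ x : ℝ × ℝ, ENNReal.ofReal
    (1 / 2 * (ε ^ 2 * x.1 ^ 2 + κ ^ 2 * x.2 ^ 2) * ‖u x‖ ^ 2 + g₀ / 2 * ‖u x‖ ^ 4)

/-- The `L²`-normalized elements of `Λ₀`. -/
def lllStates : Set (ℝ × ℝ → ℂ) := {u | u ∈ Lambda0 ∧ eLpNorm u 2 volume = 1}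

/-- `I(ε, κ) = inf {E(u) : u ∈ Λ₀, ‖u‖₂ = 1}` (it depends on `g₀` as well). The infimum is
taken in `[0, ∞]`; it is finite, as the normalized Gaussian `exp(-π|z|²/2)` has finite energy. -/
def lllMin (ε κ g₀ : ℝ) : ℝ≥0∞ := ⨅ u ∈ lllStates, energy ε κ g₀ u

/-- `u` is a minimizer of `I(ε, κ)`. -/
def IsLLLMinimizer (ε κ g₀ : ℝ) (u : ℝ × ℝ → ℂ) : Prop :=
  u ∈ lllStates ∧ energy ε κ g₀ u = lllMin ε κ g₀

/-! ### The limiting one-dimensional problem -/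

/-- The energy `∫ ½ t² p(t)² + (g₀/2) p(t)⁴ dt`, with values in `[0, ∞]`. -/
def energy1D (g₀ : ℝ) (p : ℝ → ℝ) : ℝ≥0∞ :=
  ∫⁻ t : ℝ, ENNReal.ofReal (1 / 2 * t ^ 2 * p t ^ 2 + g₀ / 2 * p t ^ 4)

/-- The real-valued `L²`-normalized functions in `L²(ℝ) ∩ L⁴(ℝ)`. -/
def states1D : Set (ℝ → ℝ) :=
  {p | MemLp p 2 volume ∧ MemLp p 4 volume ∧ eLpNorm p 2 volume = 1}

/-- The infimum `J` of the one-dimensional problem. -/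
def min1D (g₀ : ℝ) : ℝ≥0∞ := ⨅ p ∈ states1D, energy1D g₀ p

/-- `p` is a minimizer of `J`. -/
def IsMinimizer1D (g₀ : ℝ) (p : ℝ → ℝ) : Prop :=
  p ∈ states1D ∧ energy1D g₀ p = min1D g₀

/-! ### The quantities in the result -/

/-- `(I(ε, κ) - κ²/(8π)) / ε^{2/3}`. -/
def rescaledMin (ε κ g₀ : ℝ) : ℝ :=
  ((lllMin ε κ g₀).toReal - κ ^ 2 / (8 * Real.pi)) / ε ^ (2 / 3 : ℝ)

/-- `ε^{-1/3} |u(x₁ / ε^{2/3}, x₂)|`. -/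
def rescaledModulus (ε : ℝ) (u : ℝ × ℝ → ℂ) (x : ℝ × ℝ) : ℝ :=
  1 / ε ^ (1 / 3 : ℝ) * ‖u (x.1 / ε ^ (2 / 3 : ℝ), x.2)‖

/-- `2^{1/4} exp(-π x₂²) p(x₁)`. -/
def limitProfile (p : ℝ → ℝ) (x : ℝ × ℝ) : ℝ :=
  (2 : ℝ) ^ (1 / 4 : ℝ) * Real.exp (-(Real.pi * x.2 ^ 2)) * p x.1

/-- The filter on pairs `(ε, κ)` expressing `(ε, ε^{1/3} κ⁻¹) → (0, 0)`, where `ε, κ > 0` and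
`κ` stays bounded by `K`. -/
def strongRegime (K : ℝ) : Filter (ℝ × ℝ) :=
  comap (fun q : ℝ × ℝ => (q.1, q.1 ^ (1 / 3 : ℝ) / q.2)) (𝓝 (0, 0)) ⊓
    𝓟 {q | 0 < q.1 ∧ 0 < q.2 ∧ q.2 ≤ K}

/-! ### The physical parameters

`ω` is the rotation speed, `ν` the anisotropy, `ω² + ν² + ε² = 1`, and `g` is the
coupling constant of the Gross-Pitaevskii energy. -/

def alpha (ω ν : ℝ) : ℝ := √(ν ^ 4 + 4 * ω ^ 2)

def mu2 (ω ν : ℝ) : ℝ := √(1 + ω ^ 2 + alpha ω ν)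

def beta2 (ω ν : ℝ) : ℝ := 2 * ω * mu2 ω ν / (alpha ω ν + 2 * ω ^ 2 + ν ^ 2)

def gam (ω ν : ℝ) : ℝ := 2 * alpha ω ν / ω

def kappa1 (ω ν ε : ℝ) : ℝ :=
  √((2 * ν ^ 2 + ε ^ 2) * (1 + 2 * ν ^ 2 / (alpha ω ν - ν ^ 2 + 2 * ω ^ 2)))

def g1 (g ω ν : ℝ) : ℝ := g * ((alpha ω ν + 2 * ω ^ 2 + ν ^ 2) / (2 * alpha ω ν))

/-- The parameter `κ = κ₁ / β₂` of the reduced energy. -/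
def kappa (ω ν ε : ℝ) : ℝ := kappa1 ω ν ε / beta2 ω ν

/-- The coupling constant `g₀ = g₁ γ² / (4 β₂)` of the reduced energy. -/
def g0 (g ω ν : ℝ) : ℝ := g1 g ω ν * gam ω ν ^ 2 / (4 * beta2 ω ν)

/-- The filter on triples `(ω, ν, ε)` expressing `(ε, ε^{1/3} κ⁻¹) → (0, 0)`, where
`ω, ν, ε > 0`, `ω² + ν² + ε² = 1`, `κ = κ(ω, ν, ε)`, and `ω` stays above `ω₀`. -/
def physicalRegime (ω₀ : ℝ) : Filter (ℝ × ℝ × ℝ) :=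
  comap (fun P : ℝ × ℝ × ℝ => (P.2.2, P.2.2 ^ (1 / 3 : ℝ) / kappa P.1 P.2.1 P.2.2))
      (𝓝 (0, 0)) ⊓
    𝓟 {P | ω₀ ≤ P.1 ∧ 0 < P.2.1 ∧ 0 < P.2.2 ∧ P.1 ^ 2 + P.2.1 ^ 2 + P.2.2 ^ 2 = 1}

end

end AnisotropicBEC

open AnisotropicBEC

namespace AnisotropicBEC

/-! ### The Thomas-Fermi density -/

/-! Write the coupling constant as 2R³/3. The one-dimensional problem is then solved by ρ_R =
3/(4R)·(1 - t²/R²)₊. On its support t²/2 + (2R³/3)ρ_R equals R²/2, and elsewhere it is larger.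
Expanding the quartic term around ρ_R shows that the energy of q is at least 3R²/10 + (R³/3)∫(q² -
ρ_R)² (`le_energy1D`). This gives the value J = 3R²/10, a minimizer √ρ_R, and uniqueness of the
modulus.

In the lowest Landau level, moving e^{-πz²/2} into the entire factor gives |u|² = |h|²w(x₂) with h
entire and w(y) = e^{-2πy²}. Since Δ|h|² = 4|h'|², integrating against w yields ∫|h'|²w = 4π²(m -
1/(4π)), where m = ∫x₂²|u|² (`integral_norm_sq_deriv`). Hence κ²m/2 ≥ κ²/(8π), and the excess d = m
- 1/(4π) measures how far |h| is from being constant in x₂.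

Lower bound: put a = ε^{2/3} and V = ρ_{R/a}(x₁)·√2·w(x₂), and expand |u|⁴ around V. The
one-dimensional inequality in x₁ leaves an error ∫ρ_{R/a}(√2w - 1)|u|². Now (√2w - 1)w has a
primitive that decays like |y|w, so an integration by parts in x₂ bounds the error by ∫|x₂||h||h'|w
(`abs_integral_transverse_le`). Young's inequality absorbs the part linear in d into κ²d/2, up to
O(a·a/κ²), and a/κ² = (ε^{1/3}/κ)² tends to 0 (`le_energy`).

Upper bound: use states of modulus proportional to |H(bz)|e^{-πx₂²} with b = a/R and H a Gaussian
mollification of √ρ₁. The same identity computes their second moment in x₂ exactly, with excess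
O(b²) (`eventually_lllMin_le`, `exists_trial`).

For a minimizer, the two bounds force R³/3·∫(|u|² - V)² to be o(a). After rescaling this is L²
convergence of densities, hence L⁴ convergence of moduli. L² convergence follows because both moduli
have norm 1 and the limit profile is integrable (`eLpNorm_rescaledModulus_sub_le`). The estimates
are uniform for couplings in a compact subset of (0, ∞), so `lllMin_asymptotics` covers both fixed
and physical parameters. -/

/-- The normalized inverted parabola supported in `[-S, S]`. -/
noncomputable def tfDensity (S t : ℝ) : ℝ := 3 / (4 * S) * max (1 - (t / S) ^ 2) 0

/-- The square root of the Thomas-Fermi density. -/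
noncomputable def tfProfile (S t : ℝ) : ℝ := √(tfDensity S t)

lemma tfDensity_nonneg {S : ℝ} (hS : 0 < S) (t : ℝ) : 0 ≤ tfDensity S t := by
  unfold tfDensity; positivity

lemma tfProfile_sq {S : ℝ} (hS : 0 < S) (t : ℝ) : tfProfile S t ^ 2 = tfDensity S t :=
  Real.sq_sqrt (tfDensity_nonneg hS t)

lemma continuous_tfDensity (S : ℝ) : Continuous (tfDensity S) := by
  unfold tfDensity; fun_prop

lemma continuous_tfProfile (S : ℝ) : Continuous (tfProfile S) :=
  (continuous_tfDensity S).sqrt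

lemma tfDensity_eq_zero {S t : ℝ} (hS : 0 < S) (ht : S ≤ |t|) : tfDensity S t = 0 := by
  have : 1 ≤ (t / S) ^ 2 := by
    rw [one_le_sq_iff_one_le_abs, abs_div, abs_of_pos hS, le_div_iff₀ hS]; linarith
  rw [tfDensity, max_eq_right (by linarith), mul_zero]

lemma tfDensity_of_mem {S t : ℝ} (hS : 0 < S) (ht : |t| ≤ S) :
    tfDensity S t = 3 / (4 * S) * (1 - (t / S) ^ 2) := by
  have : (t / S) ^ 2 ≤ 1 := by
    rw [sq_le_one_iff_abs_le_one, abs_div, abs_of_pos hS, div_le_one hS]; exact ht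
  rw [tfDensity, max_eq_left (by linarith)]

lemma tfDensity_le {S : ℝ} (hS : 0 < S) (t : ℝ) : tfDensity S t ≤ 3 / (4 * S) := by
  unfold tfDensity
  refine mul_le_of_le_one_right (by positivity) (max_le ?_ zero_le_one)
  nlinarith [sq_nonneg (t / S)]

lemma tfDensity_scale {S a : ℝ} (hS : 0 < S) (ha : 0 < a) (t : ℝ) :
    tfDensity (S / a) (t / a) = a * tfDensity S t := by
  unfold tfDensity
  rw [div_div_div_cancel_right₀ ha.ne']
  field_simp

/-- The Euler-Lagrange inequality of the one-dimensional problem. -/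
lemma le_potential_add_tfDensity {S : ℝ} (hS : 0 < S) (t : ℝ) :
    S ^ 2 / 2 ≤ t ^ 2 / 2 + 2 / 3 * S ^ 3 * tfDensity S t := by
  have h : 2 / 3 * S ^ 3 * tfDensity S t = 1 / 2 * max (S ^ 2 - t ^ 2) 0 := by
    have : max (S ^ 2 - t ^ 2) 0 = S ^ 2 * max (1 - (t / S) ^ 2) 0 := by
      rw [mul_max_of_nonneg _ _ (sq_nonneg S), mul_zero]
      congr 1; field_simp
    rw [tfDensity, this]; field_simp; ring
  rw [h]
  linarith [le_max_left (S ^ 2 - t ^ 2) 0]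

lemma hasCompactSupport_tfDensity {S : ℝ} (hS : 0 < S) : HasCompactSupport (tfDensity S) := by
  refine HasCompactSupport.intro (isCompact_Icc (a := -S) (b := S)) fun t ht => ?_
  refine tfDensity_eq_zero hS ?_
  by_contra! h
  exact ht (abs_le.1 h.le)

lemma hasCompactSupport_tfProfile {S : ℝ} (hS : 0 < S) : HasCompactSupport (tfProfile S) :=
  (hasCompactSupport_tfDensity hS).comp_left Real.sqrt_zero

lemma integrable_tfDensity {S : ℝ} (hS : 0 < S) : Integrable (tfDensity S) :=
  (continuous_tfDensity S).integrable_of_hasCompactSupport (hasCompactSupport_tfDensity hS)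

lemma integrable_tfProfile {S : ℝ} (hS : 0 < S) : Integrable (tfProfile S) :=
  (continuous_tfProfile S).integrable_of_hasCompactSupport (hasCompactSupport_tfProfile hS)

lemma integrable_tfDensity_sq {S : ℝ} (hS : 0 < S) : Integrable (fun t => tfDensity S t ^ 2) :=
  ((continuous_tfDensity S).pow 2).integrable_of_hasCompactSupport <| by
    simpa only [sq] using (hasCompactSupport_tfDensity hS).mul_left

lemma integrable_sq_mul_tfDensity {S : ℝ} (hS : 0 < S) :
    Integrable (fun t => t ^ 2 * tfDensity S t) :=
  ((continuous_id.pow 2).mul (continuous_tfDensity S)).integrable_of_hasCompactSupport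
    (hasCompactSupport_tfDensity hS).mul_left

lemma integral_eq_intervalIntegral_of_abs {S : ℝ} {F : ℝ → ℝ}
    (hF : ∀ t, S ≤ |t| → F t = 0) : ∫ t, F t = ∫ t in (-S)..S, F t := by
  refine (intervalIntegral.integral_eq_integral_of_support_subset fun t ht => ?_).symm
  have : |t| < S := by
    by_contra! h
    exact ht (hF t h)
  exact ⟨(abs_lt.1 this).1, (abs_lt.1 this).2.le⟩

lemma abs_le_of_mem_uIcc {S t : ℝ} (hS : 0 < S) (ht : t ∈ Set.uIcc (-S) S) : |t| ≤ S := by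
  rw [Set.uIcc_of_le (by linarith)] at ht
  exact abs_le.2 ht

lemma integral_tfDensity {S : ℝ} (hS : 0 < S) : ∫ t, tfDensity S t = 1 := by
  rw [integral_eq_intervalIntegral_of_abs fun t => tfDensity_eq_zero hS]
  have h : ∀ t ∈ Set.uIcc (-S) S, HasDerivAt
      (fun t => 3 / (4 * S) * (t - t ^ 3 / (3 * S ^ 2))) (tfDensity S t) t := by
    intro t ht
    rw [tfDensity_of_mem hS (abs_le_of_mem_uIcc hS ht)]
    refine ((((hasDerivAt_id t).sub (((hasDerivAt_id t).pow 3).div_const (3 * S ^ 2))).const_mul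
      (3 / (4 * S)))).congr_deriv ?_
    simp only [id]; field_simp; ring
  rw [intervalIntegral.integral_eq_sub_of_hasDerivAt h
    (continuous_tfDensity S).continuousOn.intervalIntegrable]
  field_simp; ring

lemma integral_tfDensity_sq {S : ℝ} (hS : 0 < S) :
    ∫ t, tfDensity S t ^ 2 = 3 / (5 * S) := by
  rw [integral_eq_intervalIntegral_of_abs fun t ht => by simp [tfDensity_eq_zero hS ht]]
  have h : ∀ t ∈ Set.uIcc (-S) S, HasDerivAt
      (fun t => 9 / (16 * S ^ 2) * (t - 2 * t ^ 3 / (3 * S ^ 2) + t ^ 5 / (5 * S ^ 4)))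
      (tfDensity S t ^ 2) t := by
    intro t ht
    rw [tfDensity_of_mem hS (abs_le_of_mem_uIcc hS ht)]
    refine ((((hasDerivAt_id t).sub ((((hasDerivAt_id t).pow 3).const_mul 2).div_const
      (3 * S ^ 2))).add (((hasDerivAt_id t).pow 5).div_const (5 * S ^ 4))).const_mul
      (9 / (16 * S ^ 2))).congr_deriv ?_
    simp only [id]; field_simp; ring
  rw [intervalIntegral.integral_eq_sub_of_hasDerivAt h
    ((continuous_tfDensity S).pow 2).continuousOn.intervalIntegrable]
  field_simp; ring

lemma integral_sq_mul_tfDensity {S : ℝ} (hS : 0 < S) :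
    ∫ t, t ^ 2 * tfDensity S t = S ^ 2 / 5 := by
  rw [integral_eq_intervalIntegral_of_abs fun t ht => by simp [tfDensity_eq_zero hS ht]]
  have h : ∀ t ∈ Set.uIcc (-S) S, HasDerivAt
      (fun t => 3 / (4 * S) * (t ^ 3 / 3 - t ^ 5 / (5 * S ^ 2)))
      (t ^ 2 * tfDensity S t) t := by
    intro t ht
    rw [tfDensity_of_mem hS (abs_le_of_mem_uIcc hS ht)]
    refine (((((hasDerivAt_id t).pow 3).div_const 3).sub
      (((hasDerivAt_id t).pow 5).div_const (5 * S ^ 2))).const_mul (3 / (4 * S))).congr_deriv ?_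
    simp only [id]; field_simp; ring
  rw [intervalIntegral.integral_eq_sub_of_hasDerivAt h
    ((continuous_id.pow 2).mul (continuous_tfDensity S)).continuousOn.intervalIntegrable]
  field_simp; ring

/-! ### The one-dimensional problem -/

lemma lintegral_ofReal_norm_pow {X E : Type*} [MeasurableSpace X] [NormedAddCommGroup E]
    (μ : Measure X) (f : X → E) {n : ℕ} (hn : n ≠ 0) :
    ∫⁻ x, ENNReal.ofReal (‖f x‖ ^ n) ∂μ = eLpNorm f n μ ^ n := by
  have h := eLpNorm_nnreal_pow_eq_lintegral (f := f) (μ := μ) (p := n) (by exact_mod_cast hn)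
  simp only [NNReal.coe_natCast, ENNReal.rpow_natCast, ENNReal.coe_natCast] at h
  rw [h]
  refine lintegral_congr fun x => ?_
  rw [ENNReal.ofReal_pow (norm_nonneg _), ofReal_norm]

lemma eLpNorm_eq_lintegral_ofReal_norm_pow {X E : Type*} [MeasurableSpace X]
    [NormedAddCommGroup E] (μ : Measure X) (f : X → E) {n : ℕ} (hn : n ≠ 0) :
    eLpNorm f n μ = (∫⁻ x, ENNReal.ofReal (‖f x‖ ^ n) ∂μ) ^ (1 / n : ℝ) := by
  rw [lintegral_ofReal_norm_pow μ f hn, ← ENNReal.rpow_natCast, ← ENNReal.rpow_mul,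
    mul_one_div_cancel (by exact_mod_cast hn), ENNReal.rpow_one]

lemma tfProfile_mem_states1D {S : ℝ} (hS : 0 < S) : tfProfile S ∈ states1D := by
  have h (q : ℝ≥0∞) : MemLp (tfProfile S) q volume :=
    (continuous_tfProfile S).memLp_of_hasCompactSupport (hasCompactSupport_tfProfile hS)
  refine ⟨h 2, h 4, ?_⟩
  have h2 := lintegral_ofReal_norm_pow volume (tfProfile S) two_ne_zero
  simp only [Real.norm_eq_abs, sq_abs, tfProfile_sq hS] at h2
  rw [← ofReal_integral_eq_lintegral_ofReal (integrable_tfDensity hS)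
    (.of_forall (tfDensity_nonneg hS)), integral_tfDensity hS, ENNReal.ofReal_one] at h2
  have h3 := eLpNorm_eq_lintegral_ofReal_norm_pow volume (tfProfile S) two_ne_zero
  rw [lintegral_ofReal_norm_pow volume (tfProfile S) two_ne_zero, ← h2, ENNReal.one_rpow] at h3
  exact_mod_cast h3

lemma energy1D_tfProfile {S : ℝ} (hS : 0 < S) :
    energy1D (2 / 3 * S ^ 3) (tfProfile S) = ENNReal.ofReal (3 / 10 * S ^ 2) := by
  unfold energy1D
  have e (t : ℝ) : 1 / 2 * t ^ 2 * tfProfile S t ^ 2 + 2 / 3 * S ^ 3 / 2 * tfProfile S t ^ 4 =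
      1 / 2 * (t ^ 2 * tfDensity S t) + S ^ 3 / 3 * tfDensity S t ^ 2 := by
    rw [show tfProfile S t ^ 4 = (tfProfile S t ^ 2) ^ 2 by ring, tfProfile_sq hS]; ring
  simp only [e]
  rw [← ofReal_integral_eq_lintegral_ofReal
    (f := fun t => 1 / 2 * (t ^ 2 * tfDensity S t) + S ^ 3 / 3 * tfDensity S t ^ 2)
    (((integrable_sq_mul_tfDensity hS).const_mul _).add
      ((integrable_tfDensity_sq hS).const_mul _))
    (.of_forall fun t => by have := tfDensity_nonneg hS t; simp only [Pi.zero_apply]; positivity)]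
  rw [integral_add ((integrable_sq_mul_tfDensity hS).const_mul _)
      ((integrable_tfDensity_sq hS).const_mul _), integral_const_mul, integral_const_mul,
    integral_sq_mul_tfDensity hS, integral_tfDensity_sq hS]
  congr 1; field_simp; ring

/-- The energy of a state exceeds the Thomas-Fermi value by a multiple of the squared distance of
its density to the Thomas-Fermi density. -/
lemma le_energy1D {S : ℝ} (hS : 0 < S) {q : ℝ → ℝ} (hq : q ∈ states1D) :
    ENNReal.ofReal (3 / 10 * S ^ 2) +
        ∫⁻ t, ENNReal.ofReal (S ^ 3 / 3 * (q t ^ 2 - tfDensity S t) ^ 2) ≤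
      energy1D (2 / 3 * S ^ 3) q := by
  have hm : AEMeasurable q := hq.1.aestronglyMeasurable.aemeasurable
  have hD : Measurable (tfDensity S) := (continuous_tfDensity S).measurable
  have h2 : ∫⁻ t, ENNReal.ofReal (q t ^ 2) = 1 := by
    have h2 := lintegral_ofReal_norm_pow volume q two_ne_zero
    simp only [Real.norm_eq_abs, sq_abs, Nat.cast_ofNat, hq.2.2, one_pow] at h2
    exact h2
  -- With g = 2S³/3, expand (g/2)(q⁴ + ρ²) = gρq² + (g/2)(q² - ρ)² and bound t²/2 + gρ from below by
  -- S²/2. The finite term in ρ² stays on the right because the energy may be infinite and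
  -- subtraction in `ℝ≥0∞` truncates; it is cancelled at the end.
  have key (t : ℝ) : ENNReal.ofReal (S ^ 2 / 2) * ENNReal.ofReal (q t ^ 2) +
      ENNReal.ofReal (S ^ 3 / 3 * (q t ^ 2 - tfDensity S t) ^ 2) ≤
      ENNReal.ofReal (1 / 2 * t ^ 2 * q t ^ 2 + 2 / 3 * S ^ 3 / 2 * q t ^ 4) +
      ENNReal.ofReal (S ^ 3 / 3 * tfDensity S t ^ 2) := by
    rw [← ENNReal.ofReal_mul (by positivity), ← ENNReal.ofReal_add (by positivity) (by positivity),
      ← ENNReal.ofReal_add (by positivity) (by positivity)]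
    refine ENNReal.ofReal_le_ofReal ?_
    nlinarith [mul_le_mul_of_nonneg_right (le_potential_add_tfDensity hS t) (sq_nonneg (q t))]
  have h := lintegral_mono (μ := volume) key
  rw [lintegral_add_left' (by fun_prop), lintegral_add_right _ (by fun_prop),
    lintegral_const_mul'' _ (by fun_prop), h2, mul_one,
    ← ofReal_integral_eq_lintegral_ofReal ((integrable_tfDensity_sq hS).const_mul _)
      (.of_forall fun t => by simp only [Pi.zero_apply]; positivity), integral_const_mul,
    integral_tfDensity_sq hS] at h
  have e : ENNReal.ofReal (S ^ 2 / 2) =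
      ENNReal.ofReal (3 / 10 * S ^ 2) + ENNReal.ofReal (S ^ 3 / 3 * (3 / (5 * S))) := by
    rw [← ENNReal.ofReal_add (by positivity) (by positivity)]
    congr 1; field_simp; ring
  rw [e, add_right_comm] at h
  exact (ENNReal.add_le_add_iff_right ENNReal.ofReal_ne_top).1 h

lemma min1D_eq {S : ℝ} (hS : 0 < S) :
    min1D (2 / 3 * S ^ 3) = ENNReal.ofReal (3 / 10 * S ^ 2) := by
  refine le_antisymm ?_ ?_
  · rw [← energy1D_tfProfile hS]
    exact iInf₂_le _ (tfProfile_mem_states1D hS)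
  · exact le_iInf₂ fun q hq => le_self_add.trans (le_energy1D hS hq)

lemma isMinimizer1D_tfProfile {S : ℝ} (hS : 0 < S) :
    IsMinimizer1D (2 / 3 * S ^ 3) (tfProfile S) :=
  ⟨tfProfile_mem_states1D hS, by rw [energy1D_tfProfile hS, min1D_eq hS]⟩

lemma IsMinimizer1D.abs_eq {S : ℝ} (hS : 0 < S) {q : ℝ → ℝ}
    (hq : IsMinimizer1D (2 / 3 * S ^ 3) q) : (fun t => |q t|) =ᵐ[volume] tfProfile S := by
  have hm : AEMeasurable q := hq.1.1.aestronglyMeasurable.aemeasurable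
  have hD : Measurable (tfDensity S) := (continuous_tfDensity S).measurable
  have h := le_energy1D hS hq.1
  rw [hq.2, min1D_eq hS] at h
  have h0 : ∫⁻ t, ENNReal.ofReal (S ^ 3 / 3 * (q t ^ 2 - tfDensity S t) ^ 2) = 0 := by
    by_contra h0
    exact absurd h (not_le.2 (ENNReal.lt_add_right ENNReal.ofReal_ne_top h0))
  rw [lintegral_eq_zero_iff' (by fun_prop)] at h0
  filter_upwards [h0] with t ht
  simp only [Pi.zero_apply, ENNReal.ofReal_eq_zero] at ht
  have : (q t ^ 2 - tfDensity S t) ^ 2 ≤ 0 := by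
    by_contra! h
    have : 0 < S ^ 3 / 3 * (q t ^ 2 - tfDensity S t) ^ 2 := by positivity
    linarith
  have h3 : q t ^ 2 = tfDensity S t := by nlinarith
  rw [tfProfile, ← h3, Real.sqrt_sq_eq_abs]

/-- The radius of the Thomas-Fermi profile for the coupling constant `g`. -/
noncomputable def tfRadius (g : ℝ) : ℝ := (3 / 2 * g) ^ (1 / 3 : ℝ)

lemma tfRadius_pos {g : ℝ} (hg : 0 < g) : 0 < tfRadius g := by unfold tfRadius; positivity

lemma tfRadius_spec {g : ℝ} (hg : 0 < g) : 2 / 3 * tfRadius g ^ 3 = g := by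
  have : tfRadius g ^ 3 = 3 / 2 * g := by
    rw [tfRadius, ← Real.rpow_natCast, ← Real.rpow_mul (by positivity)]; norm_num
  rw [this]; ring

/-! ### Integration by parts for entire functions with a Gaussian weight -/

/-- The complex coordinate `x₁ + i x₂`. -/
noncomputable def cplx (x : ℝ × ℝ) : ℂ := x.1 + x.2 * Complex.I

@[fun_prop]
lemma continuous_cplx : Continuous cplx := by unfold cplx; fun_prop

lemma cplx_add_smul (x v : ℝ × ℝ) (t : ℝ) : cplx (x + t • v) = cplx x + t * cplx v := by
  simp [cplx]; ring

lemma hasLineDerivAt_comp_cplx {h : ℂ → ℂ} (hh : Differentiable ℂ h) (x v : ℝ × ℝ) :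
    HasLineDerivAt ℝ (fun x => h (cplx x)) (cplx v * deriv h (cplx x)) x v := by
  unfold HasLineDerivAt
  simp only [cplx_add_smul]
  have h1 : HasDerivAt (fun t : ℝ => cplx x + t * cplx v) (cplx v) 0 := by
    simpa using ((Complex.ofRealCLM.hasDerivAt (x := (0 : ℝ))).mul_const (cplx v)).const_add
      (cplx x)
  have h2 : HasDerivAt h (deriv h (cplx x)) (cplx x + ((0 : ℝ) : ℂ) * cplx v) := by
    simpa using (hh (cplx x)).hasDerivAt
  rw [mul_comm]
  exact h2.comp (0 : ℝ) h1

lemma Differentiable.continuous_deriv_complex {h : ℂ → ℂ} (hh : Differentiable ℂ h) :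
    Continuous (deriv h) :=
  (hh.contDiff (n := 1)).continuous_deriv le_rfl

lemma Differentiable.deriv_complex {h : ℂ → ℂ} (hh : Differentiable ℂ h) :
    Differentiable ℂ (deriv h) :=
  ((hh.contDiff (n := 2)).deriv' (n := 1)).differentiable one_ne_zero

lemma hasLineDerivAt_norm_sq {h : ℂ → ℂ} (hh : Differentiable ℂ h) (x v : ℝ × ℝ) :
    HasLineDerivAt ℝ (fun x => ‖h (cplx x)‖ ^ 2)
      (2 * inner ℝ (h (cplx x)) (cplx v * deriv h (cplx x))) x v := by
  have := HasDerivAt.norm_sq (hasLineDerivAt_comp_cplx hh x v)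
  simpa [HasLineDerivAt] using this

/-- The second derivative enters with the factor `cplx v ^ 2`. Over the two coordinate directions
these factors are 1 and i² = -1, so the sum retains only |h'|²: this is Δ|h|² = 4|h'|². -/
lemma hasLineDerivAt_inner {h : ℂ → ℂ} (hh : Differentiable ℂ h) (x v : ℝ × ℝ) :
    HasLineDerivAt ℝ (fun x => 2 * inner ℝ (h (cplx x)) (cplx v * deriv h (cplx x)))
      (2 * (inner ℝ (h (cplx x)) (cplx v ^ 2 * deriv (deriv h) (cplx x)) +
        ‖cplx v * deriv h (cplx x)‖ ^ 2)) x v := by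
  have h1 : HasDerivAt _ _ _ := hasLineDerivAt_comp_cplx hh x v
  have h2 : HasDerivAt _ _ _ := hasLineDerivAt_comp_cplx hh.deriv_complex x v
  have := (h1.inner ℝ (h2.const_mul (cplx v))).const_mul 2
  refine HasDerivAt.congr_deriv this ?_
  rw [← real_inner_self_eq_norm_sq]
  simp only [zero_smul, add_zero, sq, mul_assoc]

lemma integral_mul_lineDeriv_of_hasCompactSupport {f f' g g' : ℝ × ℝ → ℝ} {v : ℝ × ℝ}
    (hf : Continuous f) (hf' : Continuous f') (hg : Continuous g) (hg' : Continuous g')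
    (hgs : HasCompactSupport g) (hgs' : HasCompactSupport g')
    (hfd : ∀ x, HasLineDerivAt ℝ f (f' x) x v) (hgd : ∀ x, HasLineDerivAt ℝ g (g' x) x v) :
    ∫ x, f x * g' x = - ∫ x, f' x * g x :=
  integral_bilinear_hasLineDerivAt_right_eq_neg_left_of_integrable (μ := volume)
    (B := ContinuousLinearMap.mul ℝ ℝ)
    ((hf'.mul hg).integrable_of_hasCompactSupport hgs.mul_left)
    ((hf.mul hg').integrable_of_hasCompactSupport hgs'.mul_left)
    ((hf.mul hg).integrable_of_hasCompactSupport hgs.mul_left)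
    (fun x _ => hfd x) (fun x _ => hgd x)

lemma hasCompactSupport_tensor {A B : ℝ → ℝ} (hA : HasCompactSupport A)
    (hB : HasCompactSupport B) : HasCompactSupport (fun x : ℝ × ℝ => A x.1 * B x.2) := by
  refine HasCompactSupport.intro (hA.isCompact.prod hB.isCompact) fun x hx => ?_
  by_cases h1 : x.1 ∈ tsupport A
  · have h2 : x.2 ∉ tsupport B := fun h2 => hx ⟨h1, h2⟩
    rw [image_eq_zero_of_notMem_tsupport h2, mul_zero]
  · rw [image_eq_zero_of_notMem_tsupport h1, zero_mul]

lemma hasLineDerivAt_tensor_fst {A B : ℝ → ℝ} {A' : ℝ} {x : ℝ × ℝ} (hA : HasDerivAt A A' x.1) :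
    HasLineDerivAt ℝ (fun x : ℝ × ℝ => A x.1 * B x.2) (A' * B x.2) x (1, 0) := by
  unfold HasLineDerivAt
  have h1 : HasDerivAt (fun t : ℝ => x.1 + t) 1 0 := (hasDerivAt_id (0 : ℝ)).const_add x.1
  have h2 : HasDerivAt A A' (x.1 + 0) := by simpa using hA
  simpa using (h2.comp (0 : ℝ) h1).mul_const (B x.2)

lemma hasLineDerivAt_tensor_snd {A B : ℝ → ℝ} {B' : ℝ} {x : ℝ × ℝ} (hB : HasDerivAt B B' x.2) :
    HasLineDerivAt ℝ (fun x : ℝ × ℝ => A x.1 * B x.2) (A x.1 * B') x (0, 1) := by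
  unfold HasLineDerivAt
  have h1 : HasDerivAt (fun t : ℝ => x.2 + t) 1 0 := (hasDerivAt_id (0 : ℝ)).const_add x.2
  have h2 : HasDerivAt B B' (x.2 + 0) := by simpa using hB
  simpa using (h2.comp (0 : ℝ) h1).const_mul (A x.1)

/-- Green's formula for `|h|²`, `h` entire, and a compactly supported product function. -/
lemma integral_norm_sq_mul_laplacian {h : ℂ → ℂ} (hh : Differentiable ℂ h) {A B : ℝ → ℝ}
    (hA : ContDiff ℝ 2 A) (hB : ContDiff ℝ 2 B) (hAs : HasCompactSupport A)
    (hBs : HasCompactSupport B) :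
    ∫ x : ℝ × ℝ, ‖h (cplx x)‖ ^ 2 *
        (deriv (deriv A) x.1 * B x.2 + A x.1 * deriv (deriv B) x.2) =
      ∫ x : ℝ × ℝ, 4 * ‖deriv h (cplx x)‖ ^ 2 * (A x.1 * B x.2) := by
  have c0 := hh.continuous
  have c1 := hh.continuous_deriv_complex
  have c2 := hh.deriv_complex.continuous_deriv_complex
  have dA : ContDiff ℝ 1 (deriv A) := hA.deriv' (n := 1)
  have dB : ContDiff ℝ 1 (deriv B) := hB.deriv' (n := 1)
  have a0 := hA.continuous
  have a1 := dA.continuous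
  have a2 : Continuous (deriv (deriv A)) := dA.continuous_deriv le_rfl
  have b0 := hB.continuous
  have b1 := dB.continuous
  have b2 : Continuous (deriv (deriv B)) := dB.continuous_deriv le_rfl
  have hA1 (t : ℝ) : HasDerivAt A (deriv A t) t := (hA.differentiable two_ne_zero t).hasDerivAt
  have hB1 (t : ℝ) : HasDerivAt B (deriv B t) t := (hB.differentiable two_ne_zero t).hasDerivAt
  have hA2 (t : ℝ) : HasDerivAt (deriv A) (deriv (deriv A) t) t :=
    (dA.differentiable one_ne_zero t).hasDerivAt
  have hB2 (t : ℝ) : HasDerivAt (deriv B) (deriv (deriv B) t) t :=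
    (dB.differentiable one_ne_zero t).hasDerivAt
  have e1 := integral_mul_lineDeriv_of_hasCompactSupport (v := (1, 0)) (by fun_prop) (by fun_prop)
    (by fun_prop) (by fun_prop) (hasCompactSupport_tensor hAs.deriv hBs)
    (hasCompactSupport_tensor hAs.deriv.deriv hBs) (hasLineDerivAt_norm_sq hh · _)
    (fun x => hasLineDerivAt_tensor_fst (B := B) (hA2 x.1))
  have e2 := integral_mul_lineDeriv_of_hasCompactSupport (v := (1, 0)) (by fun_prop) (by fun_prop)
    (by fun_prop) (by fun_prop) (hasCompactSupport_tensor hAs hBs)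
    (hasCompactSupport_tensor hAs.deriv hBs) (hasLineDerivAt_inner hh · _)
    (fun x => hasLineDerivAt_tensor_fst (B := B) (hA1 x.1))
  have e3 := integral_mul_lineDeriv_of_hasCompactSupport (v := (0, 1)) (by fun_prop) (by fun_prop)
    (by fun_prop) (by fun_prop) (hasCompactSupport_tensor hAs hBs.deriv)
    (hasCompactSupport_tensor hAs hBs.deriv.deriv) (hasLineDerivAt_norm_sq hh · _)
    (fun x => hasLineDerivAt_tensor_snd (A := A) (hB2 x.2))
  have e4 := integral_mul_lineDeriv_of_hasCompactSupport (v := (0, 1)) (by fun_prop) (by fun_prop)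
    (by fun_prop) (by fun_prop) (hasCompactSupport_tensor hAs hBs)
    (hasCompactSupport_tensor hAs hBs.deriv) (hasLineDerivAt_inner hh · _)
    (fun x => hasLineDerivAt_tensor_snd (A := A) (hB1 x.2))
  have i {f g : ℝ × ℝ → ℝ} (hf : Continuous f) (hg : Continuous g) (hs : HasCompactSupport g) :
      Integrable (fun x => f x * g x) :=
    (hf.mul hg).integrable_of_hasCompactSupport hs.mul_left
  simp only [mul_add (‖_‖ ^ 2)]
  rw [integral_add (i (by fun_prop) (by fun_prop) (hasCompactSupport_tensor hAs.deriv.deriv hBs))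
    (i (by fun_prop) (by fun_prop) (hasCompactSupport_tensor hAs hBs.deriv.deriv)), e1, e2, e3, e4,
    neg_neg, neg_neg, ← integral_add
      (i (by fun_prop) (by fun_prop) (hasCompactSupport_tensor hAs hBs))
      (i (by fun_prop) (by fun_prop) (hasCompactSupport_tensor hAs hBs))]
  refine integral_congr_ae (.of_forall fun x => ?_)
  -- The two terms containing h'' cancel since i² = -1.
  simp [cplx, inner_neg_right]
  ring

/-! ### The Gaussian weight, its cutoffs and the second-moment identity. -/

/-- The weight `exp(-2πy²)`. -/
noncomputable def gaussWeight (y : ℝ) : ℝ := Real.exp (-(2 * Real.pi * y ^ 2))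

lemma gaussWeight_pos (y : ℝ) : 0 < gaussWeight y := Real.exp_pos _

lemma gaussWeight_le_one (y : ℝ) : gaussWeight y ≤ 1 := by
  rw [gaussWeight, Real.exp_le_one_iff]; have := Real.pi_pos; nlinarith [sq_nonneg y]

lemma contDiff_gaussWeight {n : WithTop ℕ∞} : ContDiff ℝ n gaussWeight := by
  unfold gaussWeight; fun_prop

@[fun_prop]
lemma continuous_gaussWeight : Continuous gaussWeight := contDiff_gaussWeight (n := 0) |>.continuous

lemma hasDerivAt_gaussWeight (y : ℝ) :
    HasDerivAt gaussWeight (-(4 * Real.pi * y) * gaussWeight y) y := by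
  have := (((hasDerivAt_id y).pow 2).const_mul (2 * Real.pi)).neg.exp
  refine this.congr_deriv ?_
  simp [gaussWeight]; ring

lemma deriv_gaussWeight : deriv gaussWeight = fun y => -(4 * Real.pi * y) * gaussWeight y :=
  funext fun y => (hasDerivAt_gaussWeight y).deriv

lemma deriv_deriv_gaussWeight :
    deriv (deriv gaussWeight) =
      fun y => (16 * Real.pi ^ 2 * y ^ 2 - 4 * Real.pi) * gaussWeight y := by
  ext y
  rw [deriv_gaussWeight]
  refine HasDerivAt.deriv ?_
  refine (((hasDerivAt_id y).const_mul (4 * Real.pi)).neg.mul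
    (hasDerivAt_gaussWeight y)).congr_deriv ?_
  simp; ring

lemma exists_cutoff : ∃ χ : ℝ → ℝ, ContDiff ℝ 2 χ ∧ HasCompactSupport χ ∧
    (∀ t, 0 ≤ χ t) ∧ (∀ t, χ t ≤ 1) ∧ (∀ t, |t| ≤ 1 → χ t = 1) := by
  let b : ContDiffBump (0 : ℝ) := ⟨1, 2, one_pos, one_lt_two⟩
  exact ⟨b, b.contDiff, b.hasCompactSupport, fun _ => b.nonneg, fun _ => b.le_one,
    fun t ht => b.one_of_mem_closedBall (by simpa [Metric.mem_closedBall] using ht)⟩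

lemma deriv_comp_div (χ : ℝ → ℝ) (N : ℝ) :
    deriv (fun t => χ (t / N)) = fun t => N⁻¹ * deriv χ (t / N) := by
  ext t
  simp only [div_eq_inv_mul]
  rw [deriv_comp_mul_left, smul_eq_mul]

lemma deriv_deriv_mul {f g : ℝ → ℝ} (hf : ContDiff ℝ 2 f) (hg : ContDiff ℝ 2 g) (t : ℝ) :
    deriv (deriv (fun t => f t * g t)) t =
      deriv (deriv f) t * g t + 2 * (deriv f t * deriv g t) + f t * deriv (deriv g) t := by
  have f1 := hf.differentiable two_ne_zero
  have g1 := hg.differentiable two_ne_zero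
  have f2 := (hf.deriv' (n := 1)).differentiable one_ne_zero
  have g2 := (hg.deriv' (n := 1)).differentiable one_ne_zero
  have : deriv (fun t => f t * g t) = fun t => deriv f t * g t + f t * deriv g t :=
    funext fun s => deriv_fun_mul (f1 s) (g1 s)
  rw [this]
  refine HasDerivAt.deriv ((((f2 t).hasDerivAt.mul (g1 t).hasDerivAt).add
    ((f1 t).hasDerivAt.mul (g2 t).hasDerivAt)).congr_deriv ?_)
  ring

lemma exists_bound_of_hasCompactSupport {f : ℝ → ℝ} (hf : Continuous f)
    (hs : HasCompactSupport f) : ∃ C, 0 ≤ C ∧ ∀ t, |f t| ≤ C := by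
  obtain ⟨C, hC⟩ := hf.bounded_above_of_compact_support hs
  exact ⟨C, (norm_nonneg _).trans (hC 0), hC⟩

/-- A sequence of functions in product form that exhausts the Gaussian weight, whose Laplacians
converge boundedly to the second derivative of the weight. -/
lemma exists_gaussian_cutoffs : ∃ A B : ℕ → ℝ → ℝ, ∃ C : ℝ,
    (∀ n, ContDiff ℝ 2 (A n) ∧ ContDiff ℝ 2 (B n) ∧ HasCompactSupport (A n) ∧
      HasCompactSupport (B n) ∧ ∀ x : ℝ × ℝ, 0 ≤ A n x.1 * B n x.2 ∧
        A n x.1 * B n x.2 ≤ gaussWeight x.2 ∧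
        |deriv (deriv (A n)) x.1 * B n x.2 + A n x.1 * deriv (deriv (B n)) x.2| ≤
          C * ((1 + x.2 ^ 2) * gaussWeight x.2)) ∧
    ∀ x : ℝ × ℝ, Tendsto (fun n => A n x.1 * B n x.2) atTop (𝓝 (gaussWeight x.2)) ∧
      Tendsto (fun n => deriv (deriv (A n)) x.1 * B n x.2 + A n x.1 * deriv (deriv (B n)) x.2)
        atTop (𝓝 ((16 * Real.pi ^ 2 * x.2 ^ 2 - 4 * Real.pi) * gaussWeight x.2)) := by
  obtain ⟨χ, hχ, hs, h0, h1, hone⟩ := exists_cutoff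
  have dχ : ContDiff ℝ 1 (deriv χ) := hχ.deriv' (n := 1)
  obtain ⟨C1, hC1, hb1⟩ := exists_bound_of_hasCompactSupport dχ.continuous hs.deriv
  obtain ⟨C2, hC2, hb2⟩ :=
    exists_bound_of_hasCompactSupport (dχ.continuous_deriv le_rfl) hs.deriv.deriv
  let N : ℕ → ℝ := fun n => n + 1
  have hN (n : ℕ) : 1 ≤ N n := by simp [N]
  have hNinv (n : ℕ) : (N n)⁻¹ ≤ 1 := inv_le_one_of_one_le₀ (hN n)
  have hN0 (n : ℕ) : 0 < (N n)⁻¹ := inv_pos.2 (one_pos.trans_le (hN n))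
  have hNlim : Tendsto (fun n => (N n)⁻¹) atTop (𝓝 0) := by
    simpa [N] using tendsto_one_div_add_atTop_nhds_zero_nat (𝕜 := ℝ)
  let A : ℕ → ℝ → ℝ := fun n t => χ (t / N n)
  have hA (n : ℕ) : ContDiff ℝ 2 (A n) := hχ.comp (contDiff_id.div_const _)
  have hAs (n : ℕ) : HasCompactSupport (A n) := by
    have : A n = fun t => χ ((N n)⁻¹ • t) := by ext t; simp [A, div_eq_inv_mul]
    rw [this]
    exact hs.comp_smul (hN0 n).ne'
  have dA (n : ℕ) : deriv (A n) = fun t => (N n)⁻¹ * deriv χ (t / N n) := deriv_comp_div χ (N n)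
  have ddA (n : ℕ) (t : ℝ) :
      deriv (deriv (A n)) t = (N n)⁻¹ * ((N n)⁻¹ * deriv (deriv χ) (t / N n)) := by
    rw [dA, deriv_const_mul_field', deriv_comp_div]
  have ddB (n : ℕ) (t : ℝ) : deriv (deriv (fun t => A n t * gaussWeight t)) t =
      (N n)⁻¹ * ((N n)⁻¹ * deriv (deriv χ) (t / N n)) * gaussWeight t +
      2 * ((N n)⁻¹ * deriv χ (t / N n) * (-(4 * Real.pi * t) * gaussWeight t)) +
      A n t * ((16 * Real.pi ^ 2 * t ^ 2 - 4 * Real.pi) * gaussWeight t) := by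
    rw [deriv_deriv_mul (hA n) contDiff_gaussWeight, ddA, dA, deriv_deriv_gaussWeight,
      deriv_gaussWeight]
  have bA1 (n : ℕ) (t : ℝ) : |(N n)⁻¹ * deriv χ (t / N n)| ≤ (N n)⁻¹ * C1 := by
    rw [abs_mul, abs_of_pos (hN0 n)]
    exact mul_le_mul_of_nonneg_left (hb1 _) (hN0 n).le
  have bA2 (n : ℕ) (t : ℝ) : |(N n)⁻¹ * ((N n)⁻¹ * deriv (deriv χ) (t / N n))| ≤
      (N n)⁻¹ * C2 := by
    rw [abs_mul, abs_mul, abs_of_pos (hN0 n)]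
    refine mul_le_mul_of_nonneg_left ?_ (hN0 n).le
    exact (mul_le_of_le_one_left (abs_nonneg _) (hNinv n)).trans (hb2 _)
  have hAlim (t : ℝ) : Tendsto (fun n => A n t) atTop (𝓝 1) := by
    refine tendsto_const_nhds.congr' ?_
    have h : Tendsto (fun n => |t| * (N n)⁻¹) atTop (𝓝 0) := by simpa using hNlim.const_mul |t|
    filter_upwards [h.eventually_lt_const one_pos] with n hn
    refine (hone _ ?_).symm
    rw [abs_div, abs_of_pos (one_pos.trans_le (hN n)), div_eq_mul_inv]
    exact hn.le
  have lim_zero {f : ℕ → ℝ} {C : ℝ} (hf : ∀ n, |f n| ≤ (N n)⁻¹ * C) :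
      Tendsto f atTop (𝓝 0) :=
    squeeze_zero_norm hf (by simpa using hNlim.mul_const C)
  -- The cutoff is χ(x₁/N)χ(x₂/N)w(x₂). Each derivative falling on χ costs a factor 1/N, so in the
  -- limit only w'' survives, and (1 + x₂²)w dominates throughout.
  refine ⟨A, fun n t => A n t * gaussWeight t,
    2 * C2 + 8 * Real.pi * C1 + (16 * Real.pi ^ 2 + 4 * Real.pi), fun n =>
    ⟨hA n, (hA n).mul contDiff_gaussWeight, hAs n, (hAs n).mul_right, fun x =>
    ⟨?_, ?_, ?_⟩⟩, fun x => ⟨?_, ?_⟩⟩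
  · exact mul_nonneg (h0 _) (mul_nonneg (h0 _) (gaussWeight_pos _).le)
  · have hw := gaussWeight_pos x.2
    exact (mul_le_of_le_one_left (mul_nonneg (h0 _) hw.le) (h1 _)).trans
      (mul_le_of_le_one_left hw.le (h1 _))
  · have hw := (gaussWeight_pos x.2).le
    have bd {a c : ℝ} (h : |a| ≤ (N n)⁻¹ * c) (hc : 0 ≤ c) : |a| ≤ c :=
      h.trans (mul_le_of_le_one_left hc (hNinv n))
    have b1 := bd (bA1 n x.2) hC1
    have b2 := bd (bA2 n x.2) hC2
    have b3 := bd (bA2 n x.1) hC2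
    have hp := Real.pi_pos
    have hA0 (t : ℝ) : 0 ≤ A n t := h0 _
    have hA1 (t : ℝ) : A n t ≤ 1 := h1 _
    have hAa (t : ℝ) : |A n t| ≤ 1 := by rw [abs_of_nonneg (hA0 t)]; exact hA1 t
    rw [ddB, ddA]
    set a1 := (N n)⁻¹ * deriv χ (x.2 / N n)
    set a2 := (N n)⁻¹ * ((N n)⁻¹ * deriv (deriv χ) (x.2 / N n))
    set a3 := (N n)⁻¹ * ((N n)⁻¹ * deriv (deriv χ) (x.1 / N n))
    have hy : |x.2| ≤ 1 + x.2 ^ 2 := by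
      rw [← sq_abs]; nlinarith [sq_nonneg (|x.2| - 1), abs_nonneg x.2]
    have e : a3 * (A n x.2 * gaussWeight x.2) + A n x.1 * (a2 * gaussWeight x.2 +
        2 * (a1 * (-(4 * Real.pi * x.2) * gaussWeight x.2)) +
        A n x.2 * ((16 * Real.pi ^ 2 * x.2 ^ 2 - 4 * Real.pi) * gaussWeight x.2)) =
      (a3 * A n x.2 + A n x.1 * (a2 + a1 * (-(8 * Real.pi * x.2)) +
        A n x.2 * (16 * Real.pi ^ 2 * x.2 ^ 2 - 4 * Real.pi))) * gaussWeight x.2 := by ring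
    rw [e, abs_mul, abs_of_nonneg hw, ← mul_assoc]
    refine mul_le_mul_of_nonneg_right ?_ hw
    have t1 : |a3 * A n x.2| ≤ C2 := by
      rw [abs_mul]; exact (mul_le_of_le_one_right (abs_nonneg _) (hAa _)).trans b3
    have t2 : |a1 * (-(8 * Real.pi * x.2))| ≤ 8 * Real.pi * C1 * (1 + x.2 ^ 2) := by
      rw [abs_mul a1, abs_neg, abs_mul (8 * Real.pi),
        abs_of_pos (by positivity : 0 < 8 * Real.pi)]
      calc |a1| * (8 * Real.pi * |x.2|) ≤ C1 * (8 * Real.pi * (1 + x.2 ^ 2)) := by gcongr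
        _ = _ := by ring
    have t3 : |A n x.2 * (16 * Real.pi ^ 2 * x.2 ^ 2 - 4 * Real.pi)| ≤
        (16 * Real.pi ^ 2 + 4 * Real.pi) * (1 + x.2 ^ 2) := by
      rw [abs_mul]
      refine (mul_le_of_le_one_left (abs_nonneg _) (hAa _)).trans ?_
      rw [abs_le]
      constructor <;> nlinarith [sq_nonneg x.2, mul_nonneg hp.le (sq_nonneg x.2),
        mul_nonneg (sq_nonneg Real.pi) (sq_nonneg x.2), sq_nonneg Real.pi]
    have t4 : |a2 + a1 * (-(8 * Real.pi * x.2)) +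
        A n x.2 * (16 * Real.pi ^ 2 * x.2 ^ 2 - 4 * Real.pi)| ≤
        C2 + 8 * Real.pi * C1 * (1 + x.2 ^ 2) +
        (16 * Real.pi ^ 2 + 4 * Real.pi) * (1 + x.2 ^ 2) :=
      (abs_add_three _ _ _).trans (add_le_add (add_le_add b2 t2) t3)
    refine (abs_add_le _ _).trans ?_
    rw [abs_mul (A n x.1)]
    have t5 := mul_le_of_le_one_left (abs_nonneg (a2 + a1 * (-(8 * Real.pi * x.2)) +
        A n x.2 * (16 * Real.pi ^ 2 * x.2 ^ 2 - 4 * Real.pi))) (hAa x.1)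
    nlinarith [mul_nonneg hC2 (sq_nonneg x.2)]
  · simpa using (hAlim x.1).mul ((hAlim x.2).mul_const (gaussWeight x.2))
  · simp only [ddB, ddA]
    have l1 : Tendsto _ _ _ := lim_zero fun n => bA1 n x.2
    have l2 : Tendsto _ _ _ := lim_zero fun n => bA2 n x.2
    have l3 : Tendsto _ _ _ := lim_zero fun n => bA2 n x.1
    have := (l3.mul ((hAlim x.2).mul_const (gaussWeight x.2))).add ((hAlim x.1).mul
      (((l2.mul_const (gaussWeight x.2)).add ((l1.mul_const
        (-(4 * Real.pi * x.2) * gaussWeight x.2)).const_mul 2)).add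
      ((hAlim x.2).mul_const ((16 * Real.pi ^ 2 * x.2 ^ 2 - 4 * Real.pi) * gaussWeight x.2))))
    simpa using this

/-- The second moment in `x₂` of `|h|² exp(-2πx₂²)`, `h` entire, is expressed by the derivative
of `h`. -/
lemma integral_norm_sq_deriv {h : ℂ → ℂ} (hh : Differentiable ℂ h)
    (hi : Integrable fun x : ℝ × ℝ => ‖h (cplx x)‖ ^ 2 * ((1 + x.2 ^ 2) * gaussWeight x.2)) :
    Integrable (fun x : ℝ × ℝ => ‖deriv h (cplx x)‖ ^ 2 * gaussWeight x.2) ∧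
      ∫ x : ℝ × ℝ, ‖deriv h (cplx x)‖ ^ 2 * gaussWeight x.2 =
        ∫ x : ℝ × ℝ, (4 * Real.pi ^ 2 * x.2 ^ 2 - Real.pi) *
          (‖h (cplx x)‖ ^ 2 * gaussWeight x.2) := by
  obtain ⟨A, B, C, hAB, hlim⟩ := exists_gaussian_cutoffs
  have c0 := hh.continuous
  have c1 := hh.continuous_deriv_complex
  have cA (n : ℕ) : Continuous (A n) := (hAB n).1.continuous
  have cB (n : ℕ) : Continuous (B n) := (hAB n).2.1.continuous
  have cA2 (n : ℕ) : Continuous (deriv (deriv (A n))) :=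
    ((hAB n).1.deriv' (n := 1)).continuous_deriv le_rfl
  have cB2 (n : ℕ) : Continuous (deriv (deriv (B n))) :=
    ((hAB n).2.1.deriv' (n := 1)).continuous_deriv le_rfl
  have green (n : ℕ) := integral_norm_sq_mul_laplacian hh (hAB n).1 (hAB n).2.1 (hAB n).2.2.1
    (hAB n).2.2.2.1
  have lim1 : Tendsto (fun n => ∫ x : ℝ × ℝ, ‖h (cplx x)‖ ^ 2 *
      (deriv (deriv (A n)) x.1 * B n x.2 + A n x.1 * deriv (deriv (B n)) x.2)) atTop
      (𝓝 (∫ x : ℝ × ℝ, ‖h (cplx x)‖ ^ 2 *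
        ((16 * Real.pi ^ 2 * x.2 ^ 2 - 4 * Real.pi) * gaussWeight x.2))) := by
    -- Only h is known to be integrable against the weight, so the limit is first taken on the side
    -- of Green's formula without h'.
    refine tendsto_integral_of_dominated_convergence
      (fun x => C * (‖h (cplx x)‖ ^ 2 * ((1 + x.2 ^ 2) * gaussWeight x.2)))
      (fun n => by
        have := cA n; have := cB n; have := cA2 n; have := cB2 n
        exact Continuous.aestronglyMeasurable (by fun_prop)) (hi.const_mul C)
      (fun n => .of_forall fun x => ?_) (.of_forall fun x => (hlim x).2.const_mul _)
    rw [norm_mul, Real.norm_of_nonneg (by positivity), mul_left_comm]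
    exact mul_le_mul_of_nonneg_left ((hAB n).2.2.2.2 x).2.2 (by positivity)
  simp only [green] at lim1
  have hnn (n : ℕ) (x : ℝ × ℝ) : 0 ≤ 4 * ‖deriv h (cplx x)‖ ^ 2 * (A n x.1 * B n x.2) :=
    mul_nonneg (by positivity) ((hAB n).2.2.2.2 x).1
  have hint (n : ℕ) : Integrable
      (fun x : ℝ × ℝ => 4 * ‖deriv h (cplx x)‖ ^ 2 * (A n x.1 * B n x.2)) := by
    have := cA n; have := cB n
    exact Continuous.integrable_of_hasCompactSupport (by fun_prop)
      (hasCompactSupport_tensor (hAB n).2.2.1 (hAB n).2.2.2.1).mul_left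
  have lim2 (x : ℝ × ℝ) : Tendsto
      (fun n => 4 * ‖deriv h (cplx x)‖ ^ 2 * (A n x.1 * B n x.2)) atTop
      (𝓝 (4 * ‖deriv h (cplx x)‖ ^ 2 * gaussWeight x.2)) := (hlim x).1.const_mul _
  -- Fatou's lemma gives integrability of |h'|²w from the limit just obtained, as the cut-off
  -- integrands are nonnegative. After that, |h'|²w itself serves as a dominating function.
  have hI : Integrable (fun x : ℝ × ℝ => 4 * ‖deriv h (cplx x)‖ ^ 2 * gaussWeight x.2) := by
    refine ⟨Continuous.aestronglyMeasurable (by fun_prop), ?_⟩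
    unfold HasFiniteIntegral
    rw [lintegral_congr fun x => (lim2 x).enorm.liminf_eq.symm]
    refine lt_of_le_of_lt
      (lintegral_liminf_le' fun n => (hint n).aestronglyMeasurable.aemeasurable.enorm) ?_
    have e (n : ℕ) : ∫⁻ x : ℝ × ℝ, ‖4 * ‖deriv h (cplx x)‖ ^ 2 * (A n x.1 * B n x.2)‖ₑ =
        ENNReal.ofReal (∫ x : ℝ × ℝ, 4 * ‖deriv h (cplx x)‖ ^ 2 * (A n x.1 * B n x.2)) := by
      rw [ofReal_integral_eq_lintegral_ofReal (hint n) (.of_forall (hnn n))]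
      exact lintegral_congr fun x => Real.enorm_of_nonneg (hnn n x)
    simp only [e]
    rw [(ENNReal.tendsto_ofReal lim1).liminf_eq]
    exact ENNReal.ofReal_lt_top
  have lim3 : Tendsto (fun n => ∫ x : ℝ × ℝ, 4 * ‖deriv h (cplx x)‖ ^ 2 * (A n x.1 * B n x.2))
      atTop (𝓝 (∫ x : ℝ × ℝ, 4 * ‖deriv h (cplx x)‖ ^ 2 * gaussWeight x.2)) := by
    refine tendsto_integral_of_dominated_convergence _
      (fun n => (hint n).aestronglyMeasurable) hI
      (fun n => .of_forall fun x => ?_) (.of_forall lim2)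
    rw [Real.norm_of_nonneg (hnn n x)]
    exact mul_le_mul_of_nonneg_left ((hAB n).2.2.2.2 x).2.1 (by positivity)
  have key := tendsto_nhds_unique lim3 lim1
  refine ⟨(hI.const_mul (1 / 4)).congr (.of_forall fun x => by simp only; ring), ?_⟩
  calc ∫ x : ℝ × ℝ, ‖deriv h (cplx x)‖ ^ 2 * gaussWeight x.2
      = 1 / 4 * ∫ x : ℝ × ℝ, 4 * ‖deriv h (cplx x)‖ ^ 2 * gaussWeight x.2 := by
        rw [← integral_const_mul]
        exact integral_congr_ae (.of_forall fun x => by simp only; ring)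
    _ = _ := by
        rw [key, ← integral_const_mul]
        exact integral_congr_ae (.of_forall fun x => by simp only; ring)

/-! ### The lower bound -/

lemma gaussWeight_sqrt_two_mul (y : ℝ) : gaussWeight (√2 * y) = gaussWeight y ^ 2 := by
  rw [gaussWeight, gaussWeight, ← Real.exp_nat_mul, mul_pow, Real.sq_sqrt zero_le_two]
  congr 1; push_cast; ring

lemma gaussWeight_anti {y t : ℝ} (h : |y| ≤ |t|) : gaussWeight t ≤ gaussWeight y := by
  unfold gaussWeight
  have := sq_le_sq.2 h
  have := Real.pi_pos
  gcongr

/-- The mass defect `∫_y^{√2y} exp(-2πt²) dt`. -/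
noncomputable def gaussDefect (y : ℝ) : ℝ := ∫ t in y..(√2 * y), gaussWeight t

/-- Because w(√2y) = w(y)², the upper endpoint contributes √2w². The factor √2 in the limit density
is the one for which √2w² and w have equal mass, which is why a primitive of the difference can
decay at both ends. -/
lemma hasDerivAt_gaussDefect (y : ℝ) :
    HasDerivAt gaussDefect ((√2 * gaussWeight y - 1) * gaussWeight y) y := by
  have hW (z : ℝ) : HasDerivAt (fun z => ∫ t in (0 : ℝ)..z, gaussWeight t) (gaussWeight z) z :=
    continuous_gaussWeight.integral_hasStrictDerivAt 0 z |>.hasDerivAt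
  have h1 : HasDerivAt (fun y => √2 * y) √2 y := by
    simpa using (hasDerivAt_id y).const_mul √2
  have h2 := ((hW (√2 * y)).comp y h1).sub (hW y)
  have e : gaussDefect = (fun y => ((fun z => ∫ t in (0 : ℝ)..z, gaussWeight t) ∘
      fun y => √2 * y) y - ∫ t in (0 : ℝ)..y, gaussWeight t) := by
    ext y
    have hi (a b : ℝ) : IntervalIntegrable gaussWeight volume a b :=
      continuous_gaussWeight.intervalIntegrable a b
    exact (intervalIntegral.integral_interval_sub_left (hi _ _) (hi _ _)).symm
  rw [e]
  refine h2.congr_deriv ?_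
  rw [gaussWeight_sqrt_two_mul]; ring

lemma sqrt_two_sub_one_le : √2 - 1 ≤ 1 / 2 := by
  have : √2 ≤ 3 / 2 := Real.sqrt_le_iff.2 ⟨by norm_num, by norm_num⟩
  linarith

lemma one_le_sqrt_two : 1 ≤ √2 := Real.one_le_sqrt.2 one_le_two

/-- The interval between y and √2y has length (√2 - 1)|y| ≤ |y|/2, and the weight is largest at the
endpoint y, which is the one closer to 0. -/
lemma abs_gaussDefect_le (y : ℝ) : |gaussDefect y| ≤ 1 / 2 * (|y| * gaussWeight y) := by
  have h2 := one_le_sqrt_two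
  have hb : ∀ t ∈ Set.uIoc y (√2 * y), ‖gaussWeight t‖ ≤ gaussWeight y := by
    intro t ht
    rw [Real.norm_of_nonneg (gaussWeight_pos t).le]
    refine gaussWeight_anti ?_
    rcases le_total 0 y with hy | hy
    · rw [Set.uIoc_of_le (by nlinarith)] at ht
      rw [abs_of_nonneg hy]
      exact ht.1.le.trans (le_abs_self t)
    · rw [Set.uIoc_of_ge (by nlinarith)] at ht
      rw [abs_of_nonpos hy]
      exact (neg_le_neg ht.2).trans (neg_le_abs t)
  have h := intervalIntegral.norm_integral_le_of_norm_le_const hb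
  have e : |√2 * y - y| = (√2 - 1) * |y| := by
    rw [← sub_one_mul, abs_mul, abs_of_nonneg (by linarith)]
  rw [e] at h
  refine h.trans ?_
  have := mul_nonneg (abs_nonneg y) (gaussWeight_pos y).le
  nlinarith [sqrt_two_sub_one_le]

lemma two_mul_mul_le_young {a b l : ℝ} (hl : 0 < l) : 2 * (a * b) ≤ l⁻¹ * a ^ 2 + l * b ^ 2 := by
  have : 0 ≤ l⁻¹ * (a - l * b) ^ 2 := by positivity
  have e : l⁻¹ * (a - l * b) ^ 2 = l⁻¹ * a ^ 2 + l * b ^ 2 - 2 * (a * b) := by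
    field_simp; ring
  linarith

lemma abs_two_mul_gaussWeight_sub_one_le (y : ℝ) : |√2 * gaussWeight y - 1| ≤ 1 := by
  have h0 := gaussWeight_pos y
  have h1 := gaussWeight_le_one y
  have h2 := sqrt_two_sub_one_le
  have h3 := one_le_sqrt_two
  rw [abs_le]
  constructor <;> nlinarith

/-- The transverse profile of `|h|² exp(-2πx₂²)`, `h` entire, is nearly the Gaussian one if the
derivative of `h` is small. -/
lemma abs_integral_transverse_le {h : ℂ → ℂ} (hh : Differentiable ℂ h)
    (hi : Integrable fun x : ℝ × ℝ => ‖h (cplx x)‖ ^ 2 * ((1 + x.2 ^ 2) * gaussWeight x.2))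
    {D : ℝ → ℝ} (hD : Continuous D) {M : ℝ} (hM : ∀ t, |D t| ≤ M) {l : ℝ} (hl : 0 < l) :
    |∫ x : ℝ × ℝ, ‖h (cplx x)‖ ^ 2 * (D x.1 * ((√2 * gaussWeight x.2 - 1) * gaussWeight x.2))| ≤
      M / 2 * (l⁻¹ * (∫ x : ℝ × ℝ, ‖deriv h (cplx x)‖ ^ 2 * gaussWeight x.2) +
        l * ∫ x : ℝ × ℝ, x.2 ^ 2 * (‖h (cplx x)‖ ^ 2 * gaussWeight x.2)) := by
  have c0 := hh.continuous
  have c1 := hh.continuous_deriv_complex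
  have cΦ : Continuous gaussDefect :=
    continuous_iff_continuousAt.2 fun y => (hasDerivAt_gaussDefect y).continuousAt
  have hM0 : 0 ≤ M := (abs_nonneg _).trans (hM 0)
  have hw (y : ℝ) : 0 ≤ gaussWeight y := (gaussWeight_pos y).le
  have i1 := (integral_norm_sq_deriv hh hi).1
  have i2 : Integrable fun x : ℝ × ℝ => x.2 ^ 2 * (‖h (cplx x)‖ ^ 2 * gaussWeight x.2) := by
    refine hi.mono' (Continuous.aestronglyMeasurable (by fun_prop)) (.of_forall fun x => ?_)
    rw [Real.norm_of_nonneg (mul_nonneg (by positivity) (mul_nonneg (by positivity) (hw _)))]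
    have := mul_nonneg (sq_nonneg ‖h (cplx x)‖) (hw x.2)
    nlinarith
  have idom : Integrable fun x : ℝ × ℝ => M / 2 * (l⁻¹ * (‖deriv h (cplx x)‖ ^ 2 *
      gaussWeight x.2) + l * (x.2 ^ 2 * (‖h (cplx x)‖ ^ 2 * gaussWeight x.2))) := ((i1.const_mul l⁻¹).add (i2.const_mul l)).const_mul (M / 2)
  have bd (x : ℝ × ℝ) :
      |2 * inner ℝ (h (cplx x)) (cplx (0, 1) * deriv h (cplx x)) * (D x.1 * gaussDefect x.2)| ≤
      M / 2 * (l⁻¹ * (‖deriv h (cplx x)‖ ^ 2 * gaussWeight x.2) +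
        l * (x.2 ^ 2 * (‖h (cplx x)‖ ^ 2 * gaussWeight x.2))) := by
    have b1 : |inner ℝ (h (cplx x)) (cplx (0, 1) * deriv h (cplx x))| ≤
        ‖h (cplx x)‖ * ‖deriv h (cplx x)‖ := by
      refine (abs_real_inner_le_norm _ _).trans_eq ?_
      simp [cplx]
    rw [abs_mul, abs_mul, abs_mul, abs_two]
    calc 2 * |inner ℝ (h (cplx x)) (cplx (0, 1) * deriv h (cplx x))| *
          (|D x.1| * |gaussDefect x.2|)
        ≤ 2 * (‖h (cplx x)‖ * ‖deriv h (cplx x)‖) *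
          (M * (1 / 2 * (|x.2| * gaussWeight x.2))) := by
          gcongr
          · exact hM _
          · exact abs_gaussDefect_le _
      _ = M / 2 * gaussWeight x.2 * (2 * (‖deriv h (cplx x)‖ * (|x.2| * ‖h (cplx x)‖))) := by ring
      _ ≤ M / 2 * gaussWeight x.2 *
          (l⁻¹ * ‖deriv h (cplx x)‖ ^ 2 + l * (|x.2| * ‖h (cplx x)‖) ^ 2) := by
          have := hw x.2
          gcongr
          exact two_mul_mul_le_young hl
      _ = _ := by rw [mul_pow, sq_abs]; ring
  -- Integration by parts in x₂ trades the factor (√2w - 1)w for its primitive and puts the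
  -- derivative on |h|², where it costs 2|h||h'|. The factor D depends on x₁ only and is not
  -- differentiated.
  have parts : ∫ x : ℝ × ℝ,
      ‖h (cplx x)‖ ^ 2 * (D x.1 * ((√2 * gaussWeight x.2 - 1) * gaussWeight x.2)) =
      - ∫ x : ℝ × ℝ, 2 * inner ℝ (h (cplx x)) (cplx (0, 1) * deriv h (cplx x)) *
        (D x.1 * gaussDefect x.2) := by
    refine integral_bilinear_hasLineDerivAt_right_eq_neg_left_of_integrable (μ := volume)
      (B := ContinuousLinearMap.mul ℝ ℝ) (v := (0, 1)) ?_ ?_ ?_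
      (fun x _ => hasLineDerivAt_norm_sq hh x _)
      (fun x _ => hasLineDerivAt_tensor_snd (hasDerivAt_gaussDefect x.2))
    · exact idom.mono' (Continuous.aestronglyMeasurable
        (by simp only [ContinuousLinearMap.mul_apply']; fun_prop)) (.of_forall bd)
    · refine (hi.const_mul M).mono'
        (Continuous.aestronglyMeasurable
          (by simp only [ContinuousLinearMap.mul_apply']; fun_prop)) (.of_forall fun x => ?_)
      simp only [ContinuousLinearMap.mul_apply', norm_mul, norm_pow, norm_norm]
      rw [Real.norm_of_nonneg (hw x.2), mul_left_comm M]
      refine mul_le_mul_of_nonneg_left (mul_le_mul (hM _) (mul_le_mul_of_nonneg_right ?_ (hw _))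
        (mul_nonneg (norm_nonneg _) (hw _)) hM0) (by positivity)
      exact (abs_two_mul_gaussWeight_sub_one_le _).trans (by nlinarith [sq_nonneg x.2])
    · refine (hi.const_mul M).mono'
        (Continuous.aestronglyMeasurable
          (by simp only [ContinuousLinearMap.mul_apply']; fun_prop)) (.of_forall fun x => ?_)
      simp only [ContinuousLinearMap.mul_apply', norm_mul, norm_pow, norm_norm]
      rw [mul_left_comm M]
      gcongr
      · exact hM _
      · refine (abs_gaussDefect_le _).trans ?_
        rw [← mul_assoc]
        refine mul_le_mul_of_nonneg_right ?_ (hw _)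
        rw [← sq_abs x.2]
        nlinarith [sq_nonneg (|x.2| - 1)]
  rw [parts, abs_neg, ← integral_const_mul, ← integral_const_mul,
    ← integral_add (i1.const_mul _) (i2.const_mul _), ← integral_const_mul, ← Real.norm_eq_abs]
  exact norm_integral_le_of_norm_le idom (.of_forall fun x => bd x)

/-- Multiplying f by e^{-πz²/2} keeps it entire and absorbs the decay in x₁: Re z² = x₁² - x₂², so
the remaining weight depends on x₂ alone. -/
lemma exists_entire_of_mem_Lambda0 {u : ℝ × ℝ → ℂ} (hu : u ∈ Lambda0) :
    Continuous u ∧ ∃ h : ℂ → ℂ, Differentiable ℂ h ∧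
      ∀ x, ‖u x‖ ^ 2 = ‖h (cplx x)‖ ^ 2 * gaussWeight x.2 := by
  obtain ⟨-, f, hf, hu⟩ := hu
  have hc := hf.continuous
  refine ⟨?_, fun z => f z * Complex.exp (-(Real.pi * z ^ 2 / 2)), by fun_prop, fun x => ?_⟩
  · rw [funext hu]; fun_prop
  · have hre : (-(Real.pi * cplx x ^ 2 / 2) : ℂ).re = -(Real.pi * (x.1 ^ 2 - x.2 ^ 2) / 2) := by
      have : (cplx x ^ 2).re = x.1 ^ 2 - x.2 ^ 2 := by simp [cplx, sq]
      rw [Complex.neg_re, Complex.div_ofNat_re, Complex.re_ofReal_mul, this]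
    rw [hu, norm_mul, norm_mul, Complex.norm_real, Complex.norm_exp, hre,
      Real.norm_of_nonneg (Real.exp_pos _).le, gaussWeight, mul_pow, mul_pow, ← Real.exp_nat_mul,
      ← Real.exp_nat_mul, mul_assoc, ← Real.exp_add]
    congr 2
    push_cast; ring

lemma integral_gaussWeight_sq : ∫ y, gaussWeight y ^ 2 = 1 / 2 := by
  have e (y : ℝ) : gaussWeight y ^ 2 = Real.exp (-(4 * Real.pi) * y ^ 2) := by
    rw [gaussWeight, ← Real.exp_nat_mul]; congr 1; push_cast; ring
  simp only [e]
  rw [integral_gaussian, show Real.pi / (4 * Real.pi) = (1 / 2) ^ 2 by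
    field_simp; norm_num, Real.sqrt_sq (by norm_num)]

lemma integrable_gaussWeight_sq : Integrable fun y => gaussWeight y ^ 2 := by
  -- The Bochner integral of a non-integrable function is 0 by convention, which contradicts the
  -- value 1/2.
  by_contra h
  have := integral_gaussWeight_sq
  rw [integral_undef h] at this
  norm_num at this

/-! ### The limit density and the coercive lower bound for the energy. -/

/-- The density of the limit profile of radius `S`. -/
noncomputable def limitDensity (S : ℝ) (x : ℝ × ℝ) : ℝ :=
  tfDensity S x.1 * (√2 * gaussWeight x.2)

@[fun_prop]
lemma continuous_limitDensity (S : ℝ) : Continuous (limitDensity S) := by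
  have := continuous_tfDensity S
  unfold limitDensity; fun_prop

lemma limitDensity_sq (S : ℝ) (x : ℝ × ℝ) :
    limitDensity S x ^ 2 = tfDensity S x.1 ^ 2 * (2 * gaussWeight x.2 ^ 2) := by
  rw [limitDensity, mul_pow, mul_pow, Real.sq_sqrt zero_le_two]

lemma integrable_limitDensity_sq {S : ℝ} (hS : 0 < S) :
    Integrable fun x => limitDensity S x ^ 2 := by
  simp only [limitDensity_sq]
  exact (integrable_tfDensity_sq hS).mul_prod (integrable_gaussWeight_sq.const_mul 2)

lemma integral_limitDensity_sq {S : ℝ} (hS : 0 < S) :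
    ∫ x, limitDensity S x ^ 2 = 3 / (5 * S) := by
  simp only [limitDensity_sq]
  have := integral_prod_mul (μ := volume) (ν := volume) (fun t => tfDensity S t ^ 2)
    (fun y => 2 * gaussWeight y ^ 2)
  rw [← Measure.volume_eq_prod] at this
  rw [this, integral_tfDensity_sq hS, integral_const_mul, integral_gaussWeight_sq]
  norm_num

lemma integral_norm_sq_of_mem_lllStates {u : ℝ × ℝ → ℂ} (hu : u ∈ lllStates) :
    Integrable (fun x => ‖u x‖ ^ 2) ∧ ∫ x, ‖u x‖ ^ 2 = 1 := by
  have h := lintegral_ofReal_norm_pow volume u two_ne_zero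
  rw [show ((2 : ℕ) : ℝ≥0∞) = 2 by norm_num, hu.2, one_pow] at h
  have hi : Integrable (fun x => ‖u x‖ ^ 2) := hu.1.1.integrable_norm_pow two_ne_zero
  refine ⟨hi, ?_⟩
  rw [integral_eq_lintegral_of_nonneg_ae (.of_forall fun x => by positivity)
    hi.aestronglyMeasurable, h, ENNReal.toReal_one]

/-- The energy of a state in the lowest Landau level is bounded from below by the limiting energy
and the squared distance of the density to the limit density, up to errors controlled by the excess
`d` of the second moment in `x₂`. Here `a = ε^{2/3}`. -/
lemma exists_le_energy {ε κ a R : ℝ} (ha : 0 < a) (hae : a ^ 3 = ε ^ 2) (hκ : 0 < κ) (hR : 0 < R)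
    {u : ℝ × ℝ → ℂ} (hu : u ∈ lllStates) (hE : energy ε κ (2 / 3 * R ^ 3) u ≠ ⊤) :
    Integrable (fun x => (‖u x‖ ^ 2 - limitDensity (R / a) x) ^ 2) ∧
    ∃ d, 0 ≤ d ∧ ∀ l, 0 < l →
      κ ^ 2 / (8 * Real.pi) + κ ^ 2 / 2 * d + 3 / 10 * R ^ 2 * a +
        R ^ 3 / 3 * ∫ x, (‖u x‖ ^ 2 - limitDensity (R / a) x) ^ 2 ≤
      (energy ε κ (2 / 3 * R ^ 3) u).toReal +
        R ^ 2 * a / 4 * (l⁻¹ * (4 * Real.pi ^ 2 * d) + l * (1 / (4 * Real.pi) + d)) := by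
  obtain ⟨cu, h, hh, hW⟩ := exists_entire_of_mem_Lambda0 hu.1
  obtain ⟨iW, hW1⟩ := integral_norm_sq_of_mem_lllStates hu
  have hπ := Real.pi_pos
  have hS : 0 < R / a := by positivity
  set S := R / a with hSdef
  have hnn (x : ℝ × ℝ) : 0 ≤ 1 / 2 * (ε ^ 2 * x.1 ^ 2 + κ ^ 2 * x.2 ^ 2) * ‖u x‖ ^ 2 +
      2 / 3 * R ^ 3 / 2 * ‖u x‖ ^ 4 := by positivity
  have iE : Integrable fun x : ℝ × ℝ => 1 / 2 * (ε ^ 2 * x.1 ^ 2 + κ ^ 2 * x.2 ^ 2) * ‖u x‖ ^ 2 +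
      2 / 3 * R ^ 3 / 2 * ‖u x‖ ^ 4 := by
    refine ⟨Continuous.aestronglyMeasurable (by fun_prop), ?_⟩
    rw [hasFiniteIntegral_iff_ofReal (.of_forall hnn)]
    exact hE.lt_top
  have hEint : (energy ε κ (2 / 3 * R ^ 3) u).toReal = ∫ x : ℝ × ℝ,
      (1 / 2 * (ε ^ 2 * x.1 ^ 2 + κ ^ 2 * x.2 ^ 2) * ‖u x‖ ^ 2 +
        2 / 3 * R ^ 3 / 2 * ‖u x‖ ^ 4) := by
    rw [integral_eq_lintegral_of_nonneg_ae (.of_forall hnn) iE.aestronglyMeasurable, energy]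
  have i2 : Integrable fun x : ℝ × ℝ => x.2 ^ 2 * ‖u x‖ ^ 2 := by
    refine (iE.const_mul (2 / κ ^ 2)).mono' (Continuous.aestronglyMeasurable (by fun_prop))
      (.of_forall fun x => ?_)
    rw [Real.norm_of_nonneg (by positivity)]
    have : x.2 ^ 2 * ‖u x‖ ^ 2 = 2 / κ ^ 2 * (1 / 2 * (κ ^ 2 * x.2 ^ 2) * ‖u x‖ ^ 2) := by
      field_simp
    rw [this]
    refine mul_le_mul_of_nonneg_left ?_ (by positivity)
    have : 0 ≤ 1 / 2 * (ε ^ 2 * x.1 ^ 2) * ‖u x‖ ^ 2 := by positivity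
    have : 0 ≤ 2 / 3 * R ^ 3 / 2 * ‖u x‖ ^ 4 := by positivity
    linarith
  have i4 : Integrable fun x : ℝ × ℝ => ‖u x‖ ^ 4 := by
    refine (iE.const_mul (3 / R ^ 3)).mono' (Continuous.aestronglyMeasurable (by fun_prop))
      (.of_forall fun x => ?_)
    rw [Real.norm_of_nonneg (by positivity)]
    have : ‖u x‖ ^ 4 = 3 / R ^ 3 * (2 / 3 * R ^ 3 / 2 * ‖u x‖ ^ 4) := by field_simp
    conv_lhs => rw [this]
    refine mul_le_mul_of_nonneg_left ?_ (by positivity)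
    have : 0 ≤ 1 / 2 * (ε ^ 2 * x.1 ^ 2 + κ ^ 2 * x.2 ^ 2) * ‖u x‖ ^ 2 := by positivity
    linarith
  have iv := integrable_limitDensity_sq hS
  have iG : Integrable fun x => (‖u x‖ ^ 2 - limitDensity S x) ^ 2 := by
    refine ((i4.add iv).const_mul 2).mono' (Continuous.aestronglyMeasurable (by fun_prop))
      (.of_forall fun x => ?_)
    rw [Real.norm_of_nonneg (by positivity)]
    simp only [Pi.add_apply]
    nlinarith [sq_nonneg (‖u x‖ ^ 2 + limitDensity S x)]
  -- The witness d is the excess of the second moment over 1/(4π). Both its sign and the error bound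
  -- come from ∫|h'|²w = 4π²d, derived below for the two goals at once.
  refine ⟨iG, (∫ x : ℝ × ℝ, x.2 ^ 2 * ‖u x‖ ^ 2) - 1 / (4 * Real.pi), ?_, fun l hl => ?_⟩
  all_goals
    have hi : Integrable fun x : ℝ × ℝ =>
        ‖h (cplx x)‖ ^ 2 * ((1 + x.2 ^ 2) * gaussWeight x.2) :=
      (iW.add i2).congr (.of_forall fun x => by simp only [Pi.add_apply, hW]; ring)
    obtain ⟨-, hid⟩ := integral_norm_sq_deriv hh hi
    have e1 : ∫ x : ℝ × ℝ, (4 * Real.pi ^ 2 * x.2 ^ 2 - Real.pi) *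
        (‖h (cplx x)‖ ^ 2 * gaussWeight x.2) =
        4 * Real.pi ^ 2 * ((∫ x : ℝ × ℝ, x.2 ^ 2 * ‖u x‖ ^ 2) - 1 / (4 * Real.pi)) := by
      simp only [← hW, sub_mul, mul_assoc]
      rw [integral_sub ((i2.const_mul _).const_mul _) (iW.const_mul _), integral_const_mul,
        integral_const_mul, integral_const_mul, hW1]
      field_simp
    rw [e1] at hid
  · have h0 : 0 ≤ ∫ x : ℝ × ℝ, ‖deriv h (cplx x)‖ ^ 2 * gaussWeight x.2 :=
      integral_nonneg fun x => mul_nonneg (by positivity) (gaussWeight_pos _).le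
    rw [hid] at h0
    exact nonneg_of_mul_nonneg_right h0 (by positivity)
  · have hT := abs_integral_transverse_le hh hi (continuous_tfDensity S) (M := 3 / (4 * S))
      (fun t => by rw [abs_of_nonneg (tfDensity_nonneg hS t)]; exact tfDensity_le hS t) hl
    rw [hid] at hT
    have eT : (fun x : ℝ × ℝ => ‖h (cplx x)‖ ^ 2 *
        (tfDensity S x.1 * ((√2 * gaussWeight x.2 - 1) * gaussWeight x.2))) =
        fun x => tfDensity S x.1 * ((√2 * gaussWeight x.2 - 1) * ‖u x‖ ^ 2) := by
      ext x; rw [hW]; ring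
    simp only [← hW] at hT
    rw [eT] at hT
    have cD := continuous_tfDensity S
    have iT : Integrable fun x : ℝ × ℝ =>
        tfDensity S x.1 * ((√2 * gaussWeight x.2 - 1) * ‖u x‖ ^ 2) := by
      refine (iW.const_mul (3 / (4 * S))).mono' (Continuous.aestronglyMeasurable (by fun_prop))
        (.of_forall fun x => ?_)
      rw [norm_mul, Real.norm_of_nonneg (tfDensity_nonneg hS _), norm_mul, norm_pow, norm_norm]
      gcongr
      · exact tfDensity_le hS _
      · exact mul_le_of_le_one_left (by positivity) (abs_two_mul_gaussWeight_sub_one_le _)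
    -- The expansion of |u|⁴ around V, combined with a³ times the Euler-Lagrange inequality for
    -- radius S = R/a. The scaling turns a³S²/2 into aR²/2 and a³·2S³/3 into 2R³/3. The third term
    -- on the left replaces the one-dimensional density by V.
    have hpt (x : ℝ × ℝ) : a * R ^ 2 / 2 * ‖u x‖ ^ 2 + κ ^ 2 / 2 * (x.2 ^ 2 * ‖u x‖ ^ 2) +
        2 / 3 * R ^ 3 * (tfDensity S x.1 * ((√2 * gaussWeight x.2 - 1) * ‖u x‖ ^ 2)) +
        R ^ 3 / 3 * (‖u x‖ ^ 2 - limitDensity S x) ^ 2 ≤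
        (1 / 2 * (ε ^ 2 * x.1 ^ 2 + κ ^ 2 * x.2 ^ 2) * ‖u x‖ ^ 2 +
          2 / 3 * R ^ 3 / 2 * ‖u x‖ ^ 4) + R ^ 3 / 3 * limitDensity S x ^ 2 := by
      have h1 := mul_le_mul_of_nonneg_left (le_potential_add_tfDensity hS x.1)
        (by positivity : 0 ≤ a ^ 3)
      have h2 : a ^ 3 * (S ^ 2 / 2) = a * R ^ 2 / 2 := by rw [hSdef]; field_simp
      have h3 : a ^ 3 * (x.1 ^ 2 / 2 + 2 / 3 * S ^ 3 * tfDensity S x.1) =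
          ε ^ 2 * x.1 ^ 2 / 2 + 2 / 3 * R ^ 3 * tfDensity S x.1 := by
        rw [mul_add, hae, ← hae, hSdef]; field_simp
      rw [h2, h3] at h1
      have h4 := mul_le_mul_of_nonneg_right h1 (sq_nonneg ‖u x‖)
      rw [limitDensity]
      nlinarith
    have hint := integral_mono
      ((((iW.const_mul (a * R ^ 2 / 2)).add (i2.const_mul (κ ^ 2 / 2))).add
        (iT.const_mul (2 / 3 * R ^ 3))).add (iG.const_mul (R ^ 3 / 3)))
      (iE.add (iv.const_mul (R ^ 3 / 3))) hpt
    rw [integral_add' (((iW.const_mul _).add (i2.const_mul _)).add (iT.const_mul _))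
        (iG.const_mul _), integral_add' ((iW.const_mul _).add (i2.const_mul _)) (iT.const_mul _),
      integral_add' (iW.const_mul _) (i2.const_mul _), integral_add' iE (iv.const_mul _),
      integral_const_mul, integral_const_mul, integral_const_mul, integral_const_mul,
      integral_const_mul, hW1, integral_limitDensity_sq hS, ← hEint] at hint
    have hg := mul_le_mul_of_nonneg_left (neg_le_of_abs_le hT)
      (by positivity : 0 ≤ 2 / 3 * R ^ 3)
    set m := ∫ x : ℝ × ℝ, x.2 ^ 2 * ‖u x‖ ^ 2
    have e2 : 2 / 3 * R ^ 3 * -(3 / (4 * S) / 2 *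
        (l⁻¹ * (4 * Real.pi ^ 2 * (m - 1 / (4 * Real.pi))) + l * m)) =
        -(R ^ 2 * a / 4 * (l⁻¹ * (4 * Real.pi ^ 2 * (m - 1 / (4 * Real.pi))) +
          l * (1 / (4 * Real.pi) + (m - 1 / (4 * Real.pi))))) := by
      rw [add_sub_cancel, hSdef]; field_simp
    rw [e2] at hg
    have e3 : R ^ 3 / 3 * (3 / (5 * S)) = a * R ^ 2 / 5 := by rw [hSdef]; field_simp
    rw [e3] at hint
    have e4 : κ ^ 2 / (8 * Real.pi) + κ ^ 2 / 2 * (m - 1 / (4 * Real.pi)) = κ ^ 2 / 2 * m := by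
      field_simp; ring
    rw [e4]
    linarith

/-! ### Rescaling of the first variable -/

/-- The map `x ↦ (a x₁, x₂)`. -/
noncomputable def scaleFst (a : ℝ) (ha : a ≠ 0) : ℝ × ℝ ≃ᵐ ℝ × ℝ :=
  (Homeomorph.mulLeft₀ a ha).toMeasurableEquiv.prodCongr (MeasurableEquiv.refl ℝ)

lemma scaleFst_apply {a : ℝ} (ha : a ≠ 0) (x : ℝ × ℝ) : scaleFst a ha x = (a * x.1, x.2) := rfl

lemma map_scaleFst {a : ℝ} (ha : 0 < a) :
    Measure.map (scaleFst a ha.ne') volume = ENNReal.ofReal a⁻¹ • volume := by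
  have h := Measure.map_prod_map (volume : Measure ℝ) (volume : Measure ℝ)
    (f := fun t : ℝ => a * t) (g := fun t : ℝ => t) (by fun_prop) (by fun_prop)
  rw [Real.map_volume_mul_left ha.ne', Measure.map_id', abs_of_pos (inv_pos.2 ha),
    Measure.prod_smul_left, ← Measure.volume_eq_prod] at h
  exact h.symm

lemma integral_scaleFst {a : ℝ} (ha : 0 < a) (F : ℝ × ℝ → ℝ) :
    ∫ x : ℝ × ℝ, F (a * x.1, x.2) = a⁻¹ * ∫ x, F x := by
  have := integral_map_equiv (μ := volume) (scaleFst a ha.ne') F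
  rw [map_scaleFst ha, integral_smul_measure, ENNReal.toReal_ofReal (inv_pos.2 ha).le] at this
  simpa [scaleFst_apply] using this.symm

lemma integrable_scaleFst {a : ℝ} (ha : 0 < a) {F : ℝ × ℝ → ℝ} (hF : Integrable F) :
    Integrable fun x : ℝ × ℝ => F (a * x.1, x.2) := by
  have := (integrable_map_equiv (μ := volume) (scaleFst a ha.ne') F).1
    (by rw [map_scaleFst ha]; exact hF.smul_measure ENNReal.ofReal_ne_top)
  exact this

/-! ### Trial functions -/

/-- Gaussian decay along the real direction, with at most Gaussian growth in the imaginary one. -/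
def HasGaussianDecay (H : ℂ → ℂ) : Prop :=
  ∃ K C c : ℝ, 0 < c ∧ ∀ x, ‖H (cplx x)‖ ≤ K * Real.exp (C * x.2 ^ 2 - c * x.1 ^ 2)

/-- The integrand of `trialMoment`. -/
noncomputable def trialIntegrand (H : ℂ → ℂ) (j k n : ℕ) (b : ℝ) (x : ℝ × ℝ) : ℝ :=
  x.1 ^ k * (x.2 ^ j * (‖H (cplx (x.1, b * x.2))‖ ^ n * Real.exp (-(n * Real.pi * x.2 ^ 2))))

/-- The moments of the modulus of `H (x₁ + i b x₂) exp(-πx₂²)`. -/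
noncomputable def trialMoment (H : ℂ → ℂ) (k n : ℕ) (b : ℝ) : ℝ :=
  ∫ x, trialIntegrand H 0 k n b x

lemma continuous_trialIntegrand {H : ℂ → ℂ} (hH : Continuous H) (j k n : ℕ) (b : ℝ) :
    Continuous (trialIntegrand H j k n b) := by
  unfold trialIntegrand; fun_prop

lemma integrable_pow_mul_exp_neg_mul_sq (k : ℕ) {b : ℝ} (hb : 0 < b) :
    Integrable fun t : ℝ => t ^ k * Real.exp (-b * t ^ 2) := by
  simpa using integrable_rpow_mul_exp_neg_mul_sq hb (s := k)
    (by have : (0 : ℝ) ≤ k := k.cast_nonneg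
        linarith)

/-- The second argument is scaled by b, so the growth e^{Cb²x₂²} of H is beaten by half of e^{-πx₂²}
once Cb² < π/2. The bound is then uniform in b and allows dominated convergence. -/
lemma exists_trial_bound {H : ℂ → ℂ} (hd : HasGaussianDecay H) (j k : ℕ) {n : ℕ} (hn : n ≠ 0) :
    ∃ F : ℝ × ℝ → ℝ, Integrable F ∧ ∀ᶠ b in 𝓝 (0 : ℝ), ∀ x, ‖trialIntegrand H j k n b x‖ ≤ F x := by
  obtain ⟨K, C, c, hc, hd⟩ := hd
  have hn' : (0 : ℝ) < n := by exact_mod_cast Nat.pos_of_ne_zero hn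
  have hπ := Real.pi_pos
  refine ⟨fun x => |x.1 ^ k * Real.exp (-(n * c) * x.1 ^ 2)| *
    (K ^ n * |x.2 ^ j * Real.exp (-(n * (Real.pi / 2)) * x.2 ^ 2)|), ?_, ?_⟩
  · exact (integrable_pow_mul_exp_neg_mul_sq k (by positivity)).abs.mul_prod
      ((integrable_pow_mul_exp_neg_mul_sq j (by positivity)).abs.const_mul _)
  · have hb : ∀ᶠ b in 𝓝 (0 : ℝ), C * b ^ 2 < Real.pi / 2 := by
      have : Tendsto (fun b : ℝ => C * b ^ 2) (𝓝 0) (𝓝 (C * 0 ^ 2)) :=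
        (Continuous.tendsto (by fun_prop) 0)
      exact this.eventually_lt_const (by simpa using hπ)
    filter_upwards [hb] with b hb x
    have h1 := pow_le_pow_left₀ (norm_nonneg _) (hd (x.1, b * x.2)) n
    rw [mul_pow, ← Real.exp_nat_mul] at h1
    simp only at h1
    have e1 : ‖trialIntegrand H j k n b x‖ = |x.1 ^ k| * |x.2 ^ j| *
        (‖H (cplx (x.1, b * x.2))‖ ^ n * Real.exp (-(n * Real.pi * x.2 ^ 2))) := by
      rw [trialIntegrand, Real.norm_eq_abs, abs_mul, abs_mul, ← mul_assoc]
      congr 1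
      exact abs_of_nonneg (by positivity)
    have e2 : |x.1 ^ k * Real.exp (-(n * c) * x.1 ^ 2)| *
        (K ^ n * |x.2 ^ j * Real.exp (-(n * (Real.pi / 2)) * x.2 ^ 2)|) = |x.1 ^ k| * |x.2 ^ j| *
        (K ^ n * Real.exp (-(n * c) * x.1 ^ 2 + -(n * (Real.pi / 2)) * x.2 ^ 2)) := by
      rw [abs_mul, abs_mul, abs_of_pos (Real.exp_pos _), abs_of_pos (Real.exp_pos _), Real.exp_add]
      ring
    have hK : 0 ≤ K := by
      have := (norm_nonneg _).trans (hd 0)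
      exact nonneg_of_mul_nonneg_left this (Real.exp_pos _)
    rw [e1, e2]
    refine mul_le_mul_of_nonneg_left ?_ (by positivity)
    calc ‖H (cplx (x.1, b * x.2))‖ ^ n * Real.exp (-(n * Real.pi * x.2 ^ 2))
        ≤ K ^ n * Real.exp (n * (C * (b * x.2) ^ 2 - c * x.1 ^ 2)) *
          Real.exp (-(n * Real.pi * x.2 ^ 2)) := by gcongr
      _ = K ^ n * Real.exp (n * (C * (b * x.2) ^ 2 - c * x.1 ^ 2) - n * Real.pi * x.2 ^ 2) := by
          rw [mul_assoc, ← Real.exp_add, sub_eq_add_neg _ (n * Real.pi * x.2 ^ 2)]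
      _ ≤ K ^ n * Real.exp (-(n * c) * x.1 ^ 2 + -(n * (Real.pi / 2)) * x.2 ^ 2) := by
          gcongr
          have := mul_le_mul_of_nonneg_right hb.le (mul_nonneg hn'.le (sq_nonneg x.2))
          nlinarith

lemma eventually_integrable_trialIntegrand {H : ℂ → ℂ} (hH : Continuous H)
    (hd : HasGaussianDecay H) (j k : ℕ) {n : ℕ} (hn : n ≠ 0) :
    ∀ᶠ b in 𝓝 (0 : ℝ), Integrable (trialIntegrand H j k n b) := by
  obtain ⟨F, hF, hb⟩ := exists_trial_bound hd j k hn
  filter_upwards [hb] with b hb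
  exact hF.mono' (continuous_trialIntegrand hH j k n b).aestronglyMeasurable (.of_forall hb)

lemma tendsto_trialMoment {H : ℂ → ℂ} (hH : Continuous H) (hd : HasGaussianDecay H)
    (k : ℕ) {n : ℕ} (hn : n ≠ 0) :
    Tendsto (trialMoment H k n) (𝓝 0) (𝓝 (trialMoment H k n 0)) := by
  obtain ⟨F, hF, hb⟩ := exists_trial_bound hd 0 k hn
  refine tendsto_integral_filter_of_dominated_convergence F
    (.of_forall fun b => (continuous_trialIntegrand hH 0 k n b).aestronglyMeasurable)
    (hb.mono fun b hb => .of_forall hb) hF (.of_forall fun x => ?_)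
  refine Continuous.tendsto ?_ 0
  unfold trialIntegrand
  fun_prop

/-- At b = 0 the integrand is a product, and ∫e^{-nπy²}dy = n^{-1/2}. -/
lemma trialMoment_zero (H : ℂ → ℂ) (k : ℕ) {n : ℕ} (hn : n ≠ 0) :
    trialMoment H k n 0 = (∫ t : ℝ, t ^ k * ‖H t‖ ^ n) * (√n)⁻¹ := by
  have h := integral_prod_mul (μ := volume) (ν := volume) (fun t : ℝ => t ^ k * ‖H t‖ ^ n)
    (fun y : ℝ => Real.exp (-(n * Real.pi) * y ^ 2))
  have hn' : (n : ℝ) ≠ 0 := by exact_mod_cast hn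
  rw [← Measure.volume_eq_prod, integral_gaussian,
    show Real.pi / (n * Real.pi) = (n : ℝ)⁻¹ by field_simp, Real.sqrt_inv] at h
  rw [← h, trialMoment]
  refine integral_congr_ae (.of_forall fun x => ?_)
  simp [trialIntegrand, cplx]
  ring

/-- The limiting energy of the states built from a trial function, for the radius `1`. -/
noncomputable def trialEnergy (H : ℂ → ℂ) (b : ℝ) : ℝ :=
  1 / 2 * (trialMoment H 2 2 b / trialMoment H 0 2 b) +
    1 / 3 * (trialMoment H 0 4 b / trialMoment H 0 2 b ^ 2)

lemma tendsto_trialEnergy {H : ℂ → ℂ} (hH : Continuous H) (hd : HasGaussianDecay H)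
    (h0 : trialMoment H 0 2 0 ≠ 0) :
    Tendsto (trialEnergy H) (𝓝 0) (𝓝 (trialEnergy H 0)) := by
  have h02 := tendsto_trialMoment hH hd 0 two_ne_zero
  have h22 := tendsto_trialMoment hH hd 2 two_ne_zero
  have h04 := tendsto_trialMoment hH hd 0 four_ne_zero
  exact ((h22.div h02 h0).const_mul _).add ((h04.div (h02.pow 2) (pow_ne_zero 2 h0)).const_mul _)

/-- An upper bound for `I(ε, κ)` from the trial state `H (b z) exp(iπ x₁ x₂ - πx₂²)`. -/
lemma eventually_lllMin_le {H : ℂ → ℂ} (hH : Differentiable ℂ H) (hd : HasGaussianDecay H)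
    (h0 : 0 < trialMoment H 0 2 0) :
    ∀ᶠ b in 𝓝[>] (0 : ℝ), ∀ ε κ R : ℝ, 0 < R → (b * R) ^ 3 = ε ^ 2 →
      lllMin ε κ (2 / 3 * R ^ 3) ≤ ENNReal.ofReal (κ ^ 2 / (8 * Real.pi) +
        κ ^ 2 * b ^ 2 / (8 * Real.pi ^ 2) * (trialMoment (deriv H) 0 2 b / trialMoment H 0 2 b) +
        b * R ^ 3 * trialEnergy H b) := by
  have hHc := hH.continuous
  have hH'c := hH.continuous_deriv_complex
  have hπ := Real.pi_pos
  filter_upwards [self_mem_nhdsWithin,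
    nhdsWithin_le_nhds (eventually_integrable_trialIntegrand hHc hd 0 0 two_ne_zero),
    nhdsWithin_le_nhds (eventually_integrable_trialIntegrand hHc hd 2 0 two_ne_zero),
    nhdsWithin_le_nhds (eventually_integrable_trialIntegrand hHc hd 0 2 two_ne_zero),
    nhdsWithin_le_nhds (eventually_integrable_trialIntegrand hHc hd 0 0 four_ne_zero),
    nhdsWithin_le_nhds ((tendsto_trialMoment hHc hd 0 two_ne_zero).eventually_const_lt h0)]
    with b hb i02 j02 i22 i04 hm ε κ R hR hbR
  have hb : 0 < b := hb
  set m := trialMoment H 0 2 b with hmdef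
  have hq : 0 ≤ b / m := by positivity
  have cc (x : ℝ × ℝ) : cplx (b * x.1, b * x.2) = b * cplx x := by simp [cplx]; ring
  -- The factor e^{πz²/2} undoes the x₁ decay of the lowest Landau level Gaussian, leaving modulus
  -- √(b/m)|H(bz)|e^{-πx₂²}. The normalization b/m compensates the Jacobian b⁻¹ of x₁ ↦ bx₁.
  let u : ℝ × ℝ → ℂ := fun x =>
    (√(b / m) * H (b * (x.1 + x.2 * Complex.I)) *
      Complex.exp (Real.pi * (x.1 + x.2 * Complex.I) ^ 2 / 2)) *
      (Real.exp (-(Real.pi * (x.1 ^ 2 + x.2 ^ 2) / 2)) : ℂ)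
  have cu : Continuous u := by fun_prop
  let h : ℂ → ℂ := fun z => √(b / m) * H (b * z)
  have hh : Differentiable ℂ h := by fun_prop
  have hh' (z : ℂ) : deriv h z = √(b / m) * (b * deriv H (b * z)) := by
    have h1 : HasDerivAt (fun z : ℂ => b * z) b z := by
      simpa using (hasDerivAt_id z).const_mul (b : ℂ)
    have h2 := ((hH (b * z)).hasDerivAt.comp z h1).const_mul (√(b / m) : ℂ)
    rw [mul_comm (b : ℂ) (deriv H _)]
    exact h2.deriv
  have hu2 (x : ℝ × ℝ) : ‖u x‖ ^ 2 = ‖h (cplx x)‖ ^ 2 * gaussWeight x.2 := by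
    have hre : (Real.pi * cplx x ^ 2 / 2 : ℂ).re = Real.pi * (x.1 ^ 2 - x.2 ^ 2) / 2 := by
      have : (cplx x ^ 2).re = x.1 ^ 2 - x.2 ^ 2 := by simp [cplx, sq]
      rw [Complex.div_ofNat_re, Complex.re_ofReal_mul, this]
    have : u x = h (cplx x) * (Complex.exp (Real.pi * cplx x ^ 2 / 2) *
      (Real.exp (-(Real.pi * (x.1 ^ 2 + x.2 ^ 2) / 2)) : ℂ)) := by
      simp only [u, h, cplx]; ring
    rw [this, norm_mul (h _), norm_mul (Complex.exp _), Complex.norm_real, Complex.norm_exp, hre,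
      Real.norm_of_nonneg (Real.exp_pos _).le, ← Real.exp_add, mul_pow, ← Real.exp_nat_mul,
      gaussWeight]
    congr 2
    push_cast; ring
  have hn2 (x : ℝ × ℝ) : ‖u x‖ ^ 2 = b / m * trialIntegrand H 0 0 2 b (b * x.1, x.2) := by
    rw [hu2]
    simp only [h, norm_mul, Complex.norm_real, Real.norm_of_nonneg (Real.sqrt_nonneg _), mul_pow,
      Real.sq_sqrt hq, trialIntegrand, cc, gaussWeight]
    push_cast; ring
  have hn4 (x : ℝ × ℝ) : ‖u x‖ ^ 4 = (b / m) ^ 2 * trialIntegrand H 0 0 4 b (b * x.1, x.2) := by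
    rw [show ‖u x‖ ^ 4 = (‖u x‖ ^ 2) ^ 2 by ring, hn2, mul_pow]
    congr 1
    simp only [trialIntegrand, pow_zero, one_mul, mul_pow, ← Real.exp_nat_mul, ← pow_mul]
    congr 2
    push_cast; ring
  have hx1 (x : ℝ × ℝ) : x.1 ^ 2 * ‖u x‖ ^ 2 =
      b / m * (b ^ 2)⁻¹ * trialIntegrand H 0 2 2 b (b * x.1, x.2) := by
    rw [hn2]; simp only [trialIntegrand]; field_simp
  have hx2 (x : ℝ × ℝ) : x.2 ^ 2 * ‖u x‖ ^ 2 =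
      b / m * trialIntegrand H 2 0 2 b (b * x.1, x.2) := by
    rw [hn2]; simp only [trialIntegrand]; ring
  have hdv (x : ℝ × ℝ) : ‖deriv h (cplx x)‖ ^ 2 * gaussWeight x.2 =
      b / m * b ^ 2 * trialIntegrand (deriv H) 0 0 2 b (b * x.1, x.2) := by
    simp only [hh', norm_mul, Complex.norm_real, Real.norm_of_nonneg (Real.sqrt_nonneg _), mul_pow,
      Real.sq_sqrt hq, trialIntegrand, cc, gaussWeight, Real.norm_eq_abs, sq_abs]
    push_cast; ring
  have I0 : Integrable fun x => ‖u x‖ ^ 2 := by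
    simp only [hn2]; exact (integrable_scaleFst hb i02).const_mul _
  have I1 : Integrable fun x => x.1 ^ 2 * ‖u x‖ ^ 2 := by
    simp only [hx1]; exact (integrable_scaleFst hb i22).const_mul _
  have I2 : Integrable fun x => x.2 ^ 2 * ‖u x‖ ^ 2 := by
    simp only [hx2]; exact (integrable_scaleFst hb j02).const_mul _
  have I4 : Integrable fun x => ‖u x‖ ^ 4 := by
    simp only [hn4]; exact (integrable_scaleFst hb i04).const_mul _
  have v0 : ∫ x, ‖u x‖ ^ 2 = 1 := by
    simp only [hn2]
    rw [integral_const_mul, integral_scaleFst hb, ← trialMoment, ← hmdef]; field_simp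
  have v1 : ∫ x, x.1 ^ 2 * ‖u x‖ ^ 2 = (b ^ 2)⁻¹ * (trialMoment H 2 2 b / m) := by
    simp only [hx1]
    rw [integral_const_mul, integral_scaleFst hb, ← trialMoment]; field_simp
  have v4 : ∫ x, ‖u x‖ ^ 4 = b * (trialMoment H 0 4 b / m ^ 2) := by
    simp only [hn4]
    rw [integral_const_mul, integral_scaleFst hb, ← trialMoment]; field_simp
  -- The second-moment identity, solved for the moment: the excess is ∫|h'|²w/(4π²), and each
  -- derivative of H(bz) brings a factor b.
  have v2 : ∫ x, x.2 ^ 2 * ‖u x‖ ^ 2 =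
      1 / (4 * Real.pi) + b ^ 2 / (4 * Real.pi ^ 2) * (trialMoment (deriv H) 0 2 b / m) := by
    have hi : Integrable fun x : ℝ × ℝ =>
        ‖h (cplx x)‖ ^ 2 * ((1 + x.2 ^ 2) * gaussWeight x.2) :=
      (I0.add I2).congr (.of_forall fun x => by simp only [Pi.add_apply, hu2]; ring)
    have hid := (integral_norm_sq_deriv hh hi).2
    simp only [← hu2, hdv, sub_mul, mul_assoc] at hid
    rw [integral_sub ((I2.const_mul _).const_mul _) (I0.const_mul _), integral_const_mul,
      integral_const_mul, integral_const_mul, integral_const_mul, integral_const_mul, v0,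
      integral_scaleFst hb, ← trialMoment] at hid
    have : ∫ x, x.2 ^ 2 * ‖u x‖ ^ 2 = (4 * (Real.pi ^ 2 * ∫ x, x.2 ^ 2 * ‖u x‖ ^ 2) -
      Real.pi * 1 + Real.pi) / (4 * Real.pi ^ 2) := by field_simp; ring
    rw [this, ← hid]
    field_simp; ring
  have hmem : u ∈ lllStates := by
    refine ⟨⟨(memLp_two_iff_integrable_sq_norm cu.aestronglyMeasurable).2 I0,
      fun z => √(b / m) * H (b * z) * Complex.exp (Real.pi * z ^ 2 / 2), by fun_prop,
      fun x => rfl⟩, ?_⟩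
    have := eLpNorm_eq_lintegral_ofReal_norm_pow volume u two_ne_zero
    rw [← ofReal_integral_eq_lintegral_ofReal I0 (.of_forall fun x => by positivity), v0,
      ENNReal.ofReal_one, ENNReal.one_rpow] at this
    exact_mod_cast this
  refine (iInf₂_le u hmem).trans_eq ?_
  have e (x : ℝ × ℝ) : 1 / 2 * (ε ^ 2 * x.1 ^ 2 + κ ^ 2 * x.2 ^ 2) * ‖u x‖ ^ 2 +
      2 / 3 * R ^ 3 / 2 * ‖u x‖ ^ 4 = ε ^ 2 / 2 * (x.1 ^ 2 * ‖u x‖ ^ 2) +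
      κ ^ 2 / 2 * (x.2 ^ 2 * ‖u x‖ ^ 2) + R ^ 3 / 3 * ‖u x‖ ^ 4 := by ring
  have IE := ((I1.const_mul (ε ^ 2 / 2)).add (I2.const_mul (κ ^ 2 / 2))).add
    (I4.const_mul (R ^ 3 / 3))
  rw [energy]
  simp only [e]
  refine (ofReal_integral_eq_lintegral_ofReal IE (.of_forall fun x => ?_)).symm.trans ?_
  · simp only [Pi.add_apply, Pi.zero_apply]; positivity
  rw [integral_add' ((I1.const_mul _).add (I2.const_mul _)) (I4.const_mul _),
    integral_add' (I1.const_mul _) (I2.const_mul _), integral_const_mul, integral_const_mul,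
    integral_const_mul, v1, v2, v4, ← hbR, trialEnergy, ← hmdef]
  congr 1
  field_simp
  ring

/-! ### Gaussian mollifications as trial functions -/

/-- The Gaussian transform of a function on the line, as an entire function. -/
noncomputable def gaussConv (B : ℝ) (g : ℝ → ℝ) (z : ℂ) : ℂ :=
  ∫ s : ℝ, Complex.exp (-(B * (z - s) ^ 2)) * g s

lemma norm_cexp_neg_mul_sq (B s : ℝ) (x : ℝ × ℝ) :
    ‖Complex.exp (-(B * (cplx x - s) ^ 2))‖ = Real.exp (B * x.2 ^ 2 - B * (x.1 - s) ^ 2) := by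
  have : ((cplx x - s) ^ 2).re = (x.1 - s) ^ 2 - x.2 ^ 2 := by simp [cplx, sq]
  rw [Complex.norm_exp, Complex.neg_re, Complex.re_ofReal_mul, this]
  congr 1; ring

lemma cplx_re_im (z : ℂ) : cplx (z.re, z.im) = z := Complex.re_add_im z

lemma hasDerivAt_gaussConv {B : ℝ} (hB : 0 < B) {g : ℝ → ℝ} (hg : Continuous g)
    (hs : ∀ s, 1 ≤ |s| → g s = 0) (z : ℂ) :
    HasDerivAt (gaussConv B g)
      (∫ s : ℝ, -(2 * B * (z - s)) * Complex.exp (-(B * (z - s) ^ 2)) * g s) z := by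
  have hv (t : ℝ) (ht : t ∉ Set.Icc (-1) 1) : g t = 0 := by
    refine hs t ?_
    by_contra! h
    exact ht (abs_le.1 h.le)
  have hcs : HasCompactSupport g := .intro isCompact_Icc hv
  have hcs' : HasCompactSupport fun s => (g s : ℂ) :=
    .intro isCompact_Icc fun t ht => by rw [hv t ht, Complex.ofReal_zero]
  have hm (w : ℂ) : Continuous fun s : ℝ => Complex.exp (-(B * (w - s) ^ 2)) * g s := by fun_prop
  have hm' : Continuous fun s : ℝ =>
      -(2 * B * (z - s)) * Complex.exp (-(B * (z - s) ^ 2)) * g s := by fun_prop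
  have hi : Integrable fun s : ℝ => Complex.exp (-(B * (z - s) ^ 2)) * g s :=
    (hm z).integrable_of_hasCompactSupport hcs'.mul_left
  have hbi : Integrable fun s => 2 * B * (‖z‖ + 2) * Real.exp (B * (‖z‖ + 1) ^ 2) * |g s| :=
    (hg.integrable_of_hasCompactSupport hcs).abs.const_mul _
  refine (hasDerivAt_integral_of_dominated_loc_of_deriv_le (μ := volume)
    (F := fun w (s : ℝ) => Complex.exp (-(B * (w - s) ^ 2)) * g s)
    (F' := fun w (s : ℝ) => -(2 * B * (w - s)) * Complex.exp (-(B * (w - s) ^ 2)) * g s)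
    (Metric.ball_mem_nhds z one_pos) (.of_forall fun w => (hm w).aestronglyMeasurable) hi
    hm'.aestronglyMeasurable (.of_forall fun s w hw => ?_) hbi (.of_forall fun s w hw => ?_)).2
  · rcases le_or_gt 1 |s| with h1 | h1
    · simp [hs s h1]
    · have hw1 : ‖w‖ ≤ ‖z‖ + 1 := by
        have : ‖w - z‖ < 1 := by simpa [dist_eq_norm] using hw
        linarith [norm_le_norm_add_norm_sub' w z]
      have hws : ‖w - s‖ ≤ ‖z‖ + 2 := by
        have := norm_sub_le w s
        rw [Complex.norm_real, Real.norm_eq_abs] at this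
        linarith
      have him : w.im ^ 2 ≤ (‖z‖ + 1) ^ 2 := by
        rw [← sq_abs]
        exact pow_le_pow_left₀ (abs_nonneg _) ((Complex.abs_im_le_norm w).trans hw1) 2
      have hexp := norm_cexp_neg_mul_sq B s (w.re, w.im)
      rw [cplx_re_im] at hexp
      rw [norm_mul, norm_mul, hexp, norm_neg, norm_mul, norm_mul, Complex.norm_real,
        Complex.norm_real, Real.norm_of_nonneg hB.le, Complex.norm_ofNat, Real.norm_eq_abs]
      gcongr
      nlinarith [mul_nonneg hB.le (sq_nonneg (w.re - s))]
  · have h1 : HasDerivAt (fun w : ℂ => -(B * (w - s) ^ 2)) (-(2 * B * (w - s))) w := by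
      refine ((((hasDerivAt_id w).sub_const (s : ℂ)).pow 2).const_mul (B : ℂ)).neg.congr_deriv ?_
      simp; ring
    refine (h1.cexp.mul_const (g s : ℂ)).congr_deriv ?_
    ring

lemma deriv_gaussConv {B : ℝ} (hB : 0 < B) {g : ℝ → ℝ} (hg : Continuous g)
    (hs : ∀ s, 1 ≤ |s| → g s = 0) (z : ℂ) : deriv (gaussConv B g) z =
      ∫ s : ℝ, -(2 * B * (z - s)) * Complex.exp (-(B * (z - s) ^ 2)) * g s :=
  (hasDerivAt_gaussConv hB hg hs z).deriv

lemma differentiable_gaussConv {B : ℝ} (hB : 0 < B) {g : ℝ → ℝ} (hg : Continuous g)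
    (hs : ∀ s, 1 ≤ |s| → g s = 0) : Differentiable ℂ (gaussConv B g) :=
  fun z => (hasDerivAt_gaussConv hB hg hs z).differentiableAt

lemma integrable_abs_of_vanish {g : ℝ → ℝ} (hg : Continuous g) (hs : ∀ s, 1 ≤ |s| → g s = 0) :
    Integrable fun s => |g s| := by
  refine (hg.integrable_of_hasCompactSupport (HasCompactSupport.intro
    (isCompact_Icc (a := -1) (b := 1)) fun t ht => hs t ?_)).abs
  by_contra! h
  exact ht (abs_le.1 h.le)

/-- From (t - s)² - t²/2 + s² = (t - 2s)²/2. It turns decay in t - s, for s in the support of the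
mollified function, into decay in t. -/
lemma half_sq_sub_one_le {t s : ℝ} (hs : |s| < 1) : t ^ 2 / 2 - 1 ≤ (t - s) ^ 2 := by
  have : s ^ 2 ≤ 1 := by rw [sq_le_one_iff_abs_le_one]; exact hs.le
  nlinarith [sq_nonneg (t - 2 * s)]

lemma hasGaussianDecay_gaussConv {B : ℝ} (hB : 0 < B) {g : ℝ → ℝ} (hg : Continuous g)
    (hs : ∀ s, 1 ≤ |s| → g s = 0) : HasGaussianDecay (gaussConv B g) := by
  refine ⟨Real.exp B * ∫ s, |g s|, B, B / 2, by positivity, fun x => ?_⟩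
  rw [mul_right_comm, ← integral_const_mul]
  refine norm_integral_le_of_norm_le ((integrable_abs_of_vanish hg hs).const_mul _)
    (.of_forall fun s => ?_)
  rcases le_or_gt 1 |s| with h1 | h1
  · simp [hs s h1]
  · rw [norm_mul, norm_cexp_neg_mul_sq, Complex.norm_real, Real.norm_eq_abs, ← Real.exp_add]
    gcongr
    nlinarith [mul_le_mul_of_nonneg_left (half_sq_sub_one_le (t := x.1) h1) hB.le]

/-- The prefactor |z - s| produced by differentiation is bounded by a multiple of e^{(B/2)|z - s|²}.
This spends half of the Gaussian decay in x₁ and raises the growth rate in x₂ from B to 3B/2. -/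
lemma hasGaussianDecay_deriv_gaussConv {B : ℝ} (hB : 0 < B) {g : ℝ → ℝ} (hg : Continuous g)
    (hs : ∀ s, 1 ≤ |s| → g s = 0) : HasGaussianDecay (deriv (gaussConv B g)) := by
  refine ⟨2 * B * (1 + 2 / B) * Real.exp (B / 2) * ∫ s, |g s|, 3 / 2 * B, B / 4, by positivity,
    fun x => ?_⟩
  rw [mul_right_comm, ← integral_const_mul, deriv_gaussConv hB hg hs]
  refine norm_integral_le_of_norm_le ((integrable_abs_of_vanish hg hs).const_mul _)
    (.of_forall fun s => ?_)
  rcases le_or_gt 1 |s| with h1 | h1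
  · simp [hs s h1]
  · have hr : ‖cplx x - s‖ ^ 2 = (x.1 - s) ^ 2 + x.2 ^ 2 := by
      rw [← Complex.normSq_eq_norm_sq, Complex.normSq_apply]; simp [cplx]; ring
    have hr1 : ‖cplx x - s‖ ≤
        (1 + 2 / B) * Real.exp (B / 2 * ((x.1 - s) ^ 2 + x.2 ^ 2)) := by
      have h2 := Real.add_one_le_exp (B / 2 * ((x.1 - s) ^ 2 + x.2 ^ 2))
      rw [← hr] at h2 ⊢
      refine le_trans ?_ (mul_le_mul_of_nonneg_left h2 (by positivity))
      have : (1 + 2 / B) * (B / 2 * ‖cplx x - s‖ ^ 2 + 1) =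
          ‖cplx x - s‖ ^ 2 + 1 + (2 / B + B / 2 * ‖cplx x - s‖ ^ 2) := by field_simp; ring
      rw [this]
      have : 0 ≤ 2 / B + B / 2 * ‖cplx x - s‖ ^ 2 := by positivity
      nlinarith [sq_nonneg (‖cplx x - s‖ - 1)]
    rw [norm_mul, norm_mul, norm_cexp_neg_mul_sq, norm_neg, norm_mul, norm_mul, Complex.norm_real,
      Complex.norm_real, Real.norm_of_nonneg hB.le, Complex.norm_ofNat, Real.norm_eq_abs]
    calc 2 * B * ‖cplx x - s‖ * Real.exp (B * x.2 ^ 2 - B * (x.1 - s) ^ 2) * |g s|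
        ≤ 2 * B * ((1 + 2 / B) * Real.exp (B / 2 * ((x.1 - s) ^ 2 + x.2 ^ 2))) *
          Real.exp (B * x.2 ^ 2 - B * (x.1 - s) ^ 2) * |g s| := by gcongr
      _ = 2 * B * (1 + 2 / B) * Real.exp (B / 2 * ((x.1 - s) ^ 2 + x.2 ^ 2) +
          (B * x.2 ^ 2 - B * (x.1 - s) ^ 2)) * |g s| := by rw [Real.exp_add]; ring
      _ ≤ 2 * B * (1 + 2 / B) * Real.exp (B / 2 +
          (3 / 2 * B * x.2 ^ 2 - B / 4 * x.1 ^ 2)) * |g s| := by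
          refine mul_le_mul_of_nonneg_right (mul_le_mul_of_nonneg_left (Real.exp_le_exp.2 ?_)
            (by positivity)) (abs_nonneg _)
          nlinarith [mul_le_mul_of_nonneg_left (half_sq_sub_one_le (t := x.1) h1) hB.le]
      _ = _ := by rw [Real.exp_add]; ring

lemma HasGaussianDecay.const_mul {H : ℂ → ℂ} (hH : HasGaussianDecay H) (k : ℂ) :
    HasGaussianDecay fun z => k * H z := by
  obtain ⟨K, C, c, hc, h⟩ := hH
  refine ⟨‖k‖ * K, C, c, hc, fun x => ?_⟩
  rw [norm_mul, mul_assoc]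
  exact mul_le_mul_of_nonneg_left (h x) (norm_nonneg _)

/-- The Gaussian mollifications of the Thomas-Fermi profile of radius `1`. -/
noncomputable def mollifiedProfile (c : ℝ) (z : ℂ) : ℂ :=
  √(Real.pi * c) * gaussConv (Real.pi ^ 2 * c) (tfProfile 1) z

lemma tfProfile_eq_zero {S t : ℝ} (hS : 0 < S) (ht : S ≤ |t|) : tfProfile S t = 0 := by
  rw [tfProfile, tfDensity_eq_zero hS ht, Real.sqrt_zero]

lemma tfProfile_nonneg (S t : ℝ) : 0 ≤ tfProfile S t := Real.sqrt_nonneg _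

lemma tfProfile_one_le (t : ℝ) : tfProfile 1 t ≤ 1 := by
  rw [tfProfile, Real.sqrt_le_one]
  exact (tfDensity_le one_pos t).trans (by norm_num)

/-- The kernel √(πc)·e^{-π²c(t - s)²} is a Gaussian approximate identity as c → ∞; this is the
origin of the constants in `mollifiedProfile`. -/
lemma tendsto_mollifiedProfile (t : ℝ) :
    Tendsto (fun c => ‖mollifiedProfile c t‖) atTop (𝓝 (tfProfile 1 t)) := by
  have h := Real.tendsto_integral_gaussian_smul' (V := ℝ) (f := fun s => (tfProfile 1 s : ℂ))
    (integrable_tfProfile one_pos).ofReal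
    (v := t) (Complex.continuous_ofReal.comp (continuous_tfProfile 1)).continuousAt
  have h2 := h.norm
  rw [Complex.norm_real, Real.norm_of_nonneg (tfProfile_nonneg 1 t)] at h2
  refine h2.congr' ?_
  filter_upwards [eventually_gt_atTop 0] with c hc
  rw [mollifiedProfile, gaussConv, ← integral_const_mul]
  congr 2
  ext s
  have e1 : ((Real.pi : ℂ) * c) ^ ((Module.finrank ℝ ℝ : ℂ) / 2) = (√(Real.pi * c) : ℝ) := by
    rw [Real.sqrt_eq_rpow, Complex.ofReal_cpow (by have := Real.pi_pos; positivity)]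
    simp
  have e2 : ((‖t - s‖ : ℝ) : ℂ) ^ 2 = ((t : ℂ) - s) ^ 2 := by
    rw [← Complex.ofReal_pow, Real.norm_eq_abs, sq_abs]; push_cast; ring
  rw [e1, e2, smul_eq_mul, mul_assoc]
  congr 3
  push_cast; ring

/-- Half of the exponent π²c(t - s)² gives decay in t, uniformly since c ≥ 1. The other half is
integrated in s, and √(πc) times that integral is the constant √2. -/
lemma norm_mollifiedProfile_le {c : ℝ} (hc : 1 ≤ c) (t : ℝ) :
    ‖mollifiedProfile c t‖ ≤
      √2 * Real.exp (Real.pi ^ 2 / 2) * Real.exp (-(Real.pi ^ 2 / 4) * t ^ 2) := by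
  have hπ := Real.pi_pos
  have hc0 : 0 < c := by linarith
  have hI : Integrable fun s : ℝ => Real.exp (-(Real.pi ^ 2 * c / 2) * (s - t) ^ 2) :=
    (integrable_exp_neg_mul_sq (by positivity)).comp_sub_right t
  have hv : ∫ s : ℝ, Real.exp (-(Real.pi ^ 2 * c / 2) * (s - t) ^ 2) =
      √(Real.pi / (Real.pi ^ 2 * c / 2)) := by
    rw [integral_sub_right_eq_self fun s => Real.exp (-(Real.pi ^ 2 * c / 2) * s ^ 2),
      integral_gaussian]
  have h1 : ‖gaussConv (Real.pi ^ 2 * c) (tfProfile 1) t‖ ≤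
      ∫ s : ℝ, Real.exp (Real.pi ^ 2 / 2 + -(Real.pi ^ 2 / 4) * t ^ 2) *
        Real.exp (-(Real.pi ^ 2 * c / 2) * (s - t) ^ 2) := by
    refine norm_integral_le_of_norm_le (hI.const_mul _) (.of_forall fun s => ?_)
    rcases le_or_gt 1 |s| with hs | hs
    · rw [tfProfile_eq_zero one_pos hs]; simp; positivity
    · have e := norm_cexp_neg_mul_sq (Real.pi ^ 2 * c) s (t, 0)
      have e0 : cplx (t, 0) = t := by simp [cplx]
      rw [e0] at e
      rw [norm_mul, e, Complex.norm_real, Real.norm_of_nonneg (tfProfile_nonneg 1 s), ← Real.exp_add]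
      refine (mul_le_of_le_one_right (Real.exp_pos _).le (tfProfile_one_le s)).trans ?_
      gcongr
      simp only
      have h2 := mul_le_mul_of_nonneg_left (half_sq_sub_one_le (t := t) hs) (sq_nonneg Real.pi)
      have h3 := mul_le_mul_of_nonneg_right hc
        (mul_nonneg (sq_nonneg Real.pi) (sq_nonneg (t - s)))
      nlinarith
  rw [integral_const_mul, hv] at h1
  rw [mollifiedProfile, norm_mul, Complex.norm_real, Real.norm_of_nonneg (Real.sqrt_nonneg _)]
  refine (mul_le_mul_of_nonneg_left h1 (Real.sqrt_nonneg _)).trans_eq ?_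
  rw [mul_left_comm, ← Real.sqrt_mul (by positivity),
    show Real.pi * c * (Real.pi / (Real.pi ^ 2 * c / 2)) = 2 by field_simp, Real.exp_add]
  ring

lemma continuous_mollifiedProfile {c : ℝ} (hc : 0 < c) : Continuous (mollifiedProfile c) := by
  have := (differentiable_gaussConv (B := Real.pi ^ 2 * c) (by have := Real.pi_pos; positivity)
    (continuous_tfProfile 1) fun s hs => tfProfile_eq_zero one_pos hs).continuous
  unfold mollifiedProfile
  fun_prop

lemma tendsto_trialMoment_mollifiedProfile (k : ℕ) {n : ℕ} (hn : n ≠ 0) :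
    Tendsto (fun c => trialMoment (mollifiedProfile c) k n 0) atTop
      (𝓝 ((∫ t : ℝ, t ^ k * tfProfile 1 t ^ n) * (√n)⁻¹)) := by
  have hπ := Real.pi_pos
  have hn' : (0 : ℝ) < n := by exact_mod_cast Nat.pos_of_ne_zero hn
  simp only [trialMoment_zero _ _ hn]
  refine Tendsto.mul_const _ ?_
  set K := √2 * Real.exp (Real.pi ^ 2 / 2)
  refine tendsto_integral_filter_of_dominated_convergence
    (fun t => K ^ n * |t ^ k * Real.exp (-(n * (Real.pi ^ 2 / 4)) * t ^ 2)|) ?_ ?_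
    ((integrable_pow_mul_exp_neg_mul_sq k (by positivity)).abs.const_mul _)
    (.of_forall fun t => ((tendsto_mollifiedProfile t).pow n).const_mul _)
  · filter_upwards [eventually_gt_atTop 0] with c hc
    have := continuous_mollifiedProfile hc
    exact Continuous.aestronglyMeasurable (by fun_prop)
  · filter_upwards [eventually_ge_atTop 1] with c hc
    refine .of_forall fun t => ?_
    have h := pow_le_pow_left₀ (norm_nonneg _) (norm_mollifiedProfile_le hc t) n
    rw [mul_pow, ← Real.exp_nat_mul] at h
    rw [norm_mul, norm_pow ‖_‖, norm_norm, abs_mul, abs_of_pos (Real.exp_pos _), mul_left_comm,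
      Real.norm_eq_abs]
    refine mul_le_mul_of_nonneg_left (h.trans_eq ?_) (abs_nonneg _)
    congr 2; ring

/-- Trial functions whose limiting energy is as close to optimal as desired. -/
lemma exists_trial {η : ℝ} (hη : 0 < η) : ∃ H : ℂ → ℂ, Differentiable ℂ H ∧ HasGaussianDecay H ∧
    HasGaussianDecay (deriv H) ∧ 0 < trialMoment H 0 2 0 ∧ trialEnergy H 0 < 3 / 10 + η := by
  have hπ := Real.pi_pos
  have p4 (t : ℝ) : tfProfile 1 t ^ 4 = tfDensity 1 t ^ 2 := by
    rw [show tfProfile 1 t ^ 4 = (tfProfile 1 t ^ 2) ^ 2 by ring, tfProfile_sq one_pos]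
  have m02 := tendsto_trialMoment_mollifiedProfile 0 two_ne_zero
  have m22 := tendsto_trialMoment_mollifiedProfile 2 two_ne_zero
  have m04 := tendsto_trialMoment_mollifiedProfile 0 four_ne_zero
  simp only [pow_zero, one_mul, tfProfile_sq one_pos, integral_tfDensity one_pos] at m02
  simp only [tfProfile_sq one_pos, integral_sq_mul_tfDensity one_pos] at m22
  simp only [pow_zero, one_mul, p4, integral_tfDensity_sq one_pos] at m04
  have h2 : 0 < (√((2 : ℕ) : ℝ))⁻¹ := by positivity
  have hE := ((m22.div m02 h2.ne').const_mul (1 / 2)).add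
    ((m04.div (m02.pow 2) (by positivity)).const_mul (1 / 3))
  -- The transverse factors cancel: the second moments share 1/√2, and 1/√4 = (1/√2)². What remains
  -- is the one-dimensional energy of radius 1, namely 1/10 + 1/5.
  have e : 1 / 2 * (1 ^ 2 / 5 * (√((2 : ℕ) : ℝ))⁻¹ / (√((2 : ℕ) : ℝ))⁻¹) +
      1 / 3 * (3 / (5 * 1) * (√((4 : ℕ) : ℝ))⁻¹ / ((√((2 : ℕ) : ℝ))⁻¹) ^ 2) = (3 / 10 : ℝ) := by
    rw [mul_div_assoc, div_self h2.ne', inv_pow, Real.sq_sqrt (by positivity)]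
    rw [show (((4 : ℕ) : ℝ)) = 2 ^ 2 by norm_num, Real.sqrt_sq (by norm_num)]
    norm_num
  rw [e] at hE
  obtain ⟨c, hc, hm, hlt⟩ := ((eventually_gt_atTop (0 : ℝ)).and
    ((m02.eventually_const_lt h2).and (hE.eventually_lt_const (lt_add_of_pos_right _ hη)))).exists
  have hv : ∀ s, 1 ≤ |s| → tfProfile 1 s = 0 := fun s hs => tfProfile_eq_zero one_pos hs
  have hB : 0 < Real.pi ^ 2 * c := by positivity
  have hd := differentiable_gaussConv hB (continuous_tfProfile 1) hv
  refine ⟨mollifiedProfile c, hd.const_mul _,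
    (hasGaussianDecay_gaussConv hB (continuous_tfProfile 1) hv).const_mul _, ?_, hm, hlt⟩
  have : deriv (mollifiedProfile c) =
      fun z => √(Real.pi * c) * deriv (gaussConv (Real.pi ^ 2 * c) (tfProfile 1)) z :=
    funext fun z => deriv_const_mul_field _
  rw [this]
  exact (hasGaussianDecay_deriv_gaussConv hB (continuous_tfProfile 1) hv).const_mul _

/-! ### Asymptotics of the minimal energy -/

/-- The lower bound of the energy after absorbing the errors in the transverse excess;
here `a = ε^{2/3}`. -/
lemma le_energy {ε κ a R : ℝ} (ha : 0 < a) (hae : a ^ 3 = ε ^ 2) (hκ : 0 < κ) (hR : 0 < R)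
    (hsmall : Real.pi ^ 2 * R ^ 4 * (a / κ ^ 2) ^ 2 ≤ 1 / 4)
    {u : ℝ × ℝ → ℂ} (hu : u ∈ lllStates) (hE : energy ε κ (2 / 3 * R ^ 3) u ≠ ⊤) :
    κ ^ 2 / (8 * Real.pi) + 3 / 10 * R ^ 2 * a +
        R ^ 3 / 3 * ∫ x, (‖u x‖ ^ 2 - limitDensity (R / a) x) ^ 2 ≤
      (energy ε κ (2 / 3 * R ^ 3) u).toReal + Real.pi / 4 * R ^ 4 * a * (a / κ ^ 2) := by
  obtain ⟨-, d, hd, h⟩ := exists_le_energy ha hae hκ hR hu hE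
  have hπ := Real.pi_pos
  -- This Young parameter makes the l⁻¹ term equal to κ²d/4. The smallness hypothesis bounds the
  -- other d term by κ²d/4 as well, so together they use up exactly κ²d/2.
  have h1 := h (4 * Real.pi ^ 2 * R ^ 2 * (a / κ ^ 2)) (by positivity)
  have e : R ^ 2 * a / 4 * ((4 * Real.pi ^ 2 * R ^ 2 * (a / κ ^ 2))⁻¹ * (4 * Real.pi ^ 2 * d) +
      4 * Real.pi ^ 2 * R ^ 2 * (a / κ ^ 2) * (1 / (4 * Real.pi) + d)) =
      κ ^ 2 * d / 4 + Real.pi / 4 * R ^ 4 * a * (a / κ ^ 2) +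
      Real.pi ^ 2 * R ^ 4 * (a / κ ^ 2) ^ 2 * (κ ^ 2 * d) := by
    field_simp; ring
  rw [e] at h1
  have h2 := mul_le_mul_of_nonneg_right hsmall (by positivity : 0 ≤ κ ^ 2 * d)
  linarith

lemma le_lllMin {ε κ a R : ℝ} (ha : 0 < a) (hae : a ^ 3 = ε ^ 2) (hκ : 0 < κ) (hR : 0 < R)
    (hsmall : Real.pi ^ 2 * R ^ 4 * (a / κ ^ 2) ^ 2 ≤ 1 / 4) :
    ENNReal.ofReal (κ ^ 2 / (8 * Real.pi) + 3 / 10 * R ^ 2 * a -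
      Real.pi / 4 * R ^ 4 * a * (a / κ ^ 2)) ≤ lllMin ε κ (2 / 3 * R ^ 3) := by
  refine le_iInf₂ fun u hu => ?_
  by_cases hE : energy ε κ (2 / 3 * R ^ 3) u = ⊤
  · rw [hE]; exact le_top
  · refine ENNReal.ofReal_le_of_le_toReal ?_
    have h := le_energy ha hae hκ hR hsmall hu hE
    have : 0 ≤ R ^ 3 / 3 * ∫ x, (‖u x‖ ^ 2 - limitDensity (R / a) x) ^ 2 :=
      mul_nonneg (by positivity) (integral_nonneg fun x => sq_nonneg _)
    linarith

/-! ### Limits along a filter, with the radius R in a fixed interval. -/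

section Asymptotics

variable {ι : Type*} {l : Filter ι} {ε κ R : ι → ℝ} {K r r' : ℝ}

lemma rpow_two_thirds_pow_three {e : ℝ} (he : 0 < e) : (e ^ (2 / 3 : ℝ)) ^ 3 = e ^ 2 := by
  rw [← Real.rpow_natCast, ← Real.rpow_mul he.le, ← Real.rpow_natCast]; norm_num

lemma rpow_one_third_sq {e : ℝ} (he : 0 < e) : (e ^ (1 / 3 : ℝ)) ^ 2 = e ^ (2 / 3 : ℝ) := by
  rw [← Real.rpow_natCast, ← Real.rpow_mul he.le]; norm_num

lemma tendsto_rpow_two_thirds (hε : Tendsto ε l (𝓝 0)) :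
    Tendsto (fun i => ε i ^ (2 / 3 : ℝ)) l (𝓝 0) := by
  have := hε.rpow_const (p := 2 / 3) (Or.inr (by norm_num))
  rwa [Real.zero_rpow (by norm_num)] at this

/-- The upper bound of the minimal energy. -/
lemma eventually_lllMin_le_of_tendsto (hr : 0 < r)
    (h : ∀ᶠ i in l, 0 < ε i ∧ 0 < κ i ∧ κ i ≤ K ∧ r ≤ R i ∧ R i ≤ r')
    (hε : Tendsto ε l (𝓝 0)) {η : ℝ} (hη : 0 < η) :
    ∀ᶠ i in l, lllMin (ε i) (κ i) (2 / 3 * R i ^ 3) ≤ ENNReal.ofReal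
      (κ i ^ 2 / (8 * Real.pi) + ε i ^ (2 / 3 : ℝ) * (3 / 10 * R i ^ 2 + η)) := by
  have hπ := Real.pi_pos
  -- The trial energy is multiplied by R² ≤ r'² + 1, so this tolerance leaves at most η/2. The other
  -- half of η is for the transverse excess.
  obtain ⟨H, hH, hd, hd', h0, hlt⟩ := exists_trial (η := η / (2 * (r' ^ 2 + 1))) (by positivity)
  have ha := tendsto_rpow_two_thirds hε
  have hb : Tendsto (fun i => ε i ^ (2 / 3 : ℝ) / R i) l (𝓝[>] 0) := by
    refine tendsto_nhdsWithin_iff.2 ⟨?_, h.mono fun i hi => ?_⟩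
    · refine tendsto_of_tendsto_of_tendsto_of_le_of_le' tendsto_const_nhds
        (by simpa using ha.div_const r) (h.mono fun i hi => ?_) (h.mono fun i hi => ?_)
      · have := hi.1; have := hr.trans_le hi.2.2.2.1; positivity
      · have := hi.1
        exact div_le_div_of_nonneg_left (by positivity) hr hi.2.2.2.1
    · have := hi.1; have := hr.trans_le hi.2.2.2.1
      exact div_pos (by positivity) this
  have hq : Tendsto (fun b => trialMoment (deriv H) 0 2 b / trialMoment H 0 2 b) (𝓝[>] 0)
      (𝓝 (trialMoment (deriv H) 0 2 0 / trialMoment H 0 2 0)) :=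
    ((tendsto_trialMoment hH.continuous_deriv_complex hd' 0 two_ne_zero).div
      (tendsto_trialMoment hH.continuous hd 0 two_ne_zero) h0.ne').mono_left nhdsWithin_le_nhds
  set q := trialMoment (deriv H) 0 2 0 / trialMoment H 0 2 0
  have hT := (tendsto_trialEnergy hH.continuous hd h0.ne').mono_left
    (nhdsWithin_le_nhds (s := Set.Ioi 0))
  have hz : Tendsto (fun i => K ^ 2 / (8 * Real.pi ^ 2 * r ^ 2) * (|q| + 1) *
      ε i ^ (2 / 3 : ℝ)) l (𝓝 0) := by
    simpa using ha.const_mul (K ^ 2 / (8 * Real.pi ^ 2 * r ^ 2) * (|q| + 1))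
  filter_upwards [h, hb.eventually (eventually_lllMin_le hH hd h0),
    hb.eventually (hq.eventually_lt_const ((le_abs_self q).trans_lt (lt_add_one |q|))),
    hb.eventually (hT.eventually_lt_const hlt),
    hz.eventually_lt_const (half_pos hη)] with i ⟨he, hk, hkK, hr1, hr2⟩ h1 h2 h3 h4
  have hR := hr.trans_le hr1
  have ha0 : 0 < ε i ^ (2 / 3 : ℝ) := by positivity
  set a := ε i ^ (2 / 3 : ℝ) with hadef
  refine (h1 (ε i) (κ i) (R i) hR
    (by rw [div_mul_cancel₀ _ hR.ne']; exact rpow_two_thirds_pow_three he)).trans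
    (ENNReal.ofReal_le_ofReal ?_)
  -- The transverse excess is O(K²a²), hence o(a); the bound on κ enters here.
  have b1 : κ i ^ 2 * (a / R i) ^ 2 / (8 * Real.pi ^ 2) *
      (trialMoment (deriv H) 0 2 (a / R i) / trialMoment H 0 2 (a / R i)) ≤ a * (η / 2) := by
    calc κ i ^ 2 * (a / R i) ^ 2 / (8 * Real.pi ^ 2) *
        (trialMoment (deriv H) 0 2 (a / R i) / trialMoment H 0 2 (a / R i))
        ≤ K ^ 2 * (a / r) ^ 2 / (8 * Real.pi ^ 2) * (|q| + 1) := by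
          refine (mul_le_mul_of_nonneg_left h2.le (by positivity)).trans ?_
          gcongr
      _ = a * (K ^ 2 / (8 * Real.pi ^ 2 * r ^ 2) * (|q| + 1) * a) := by field_simp
      _ ≤ _ := mul_le_mul_of_nonneg_left h4.le ha0.le
  have b2 : a / R i * R i ^ 3 * trialEnergy H (a / R i) ≤ a * (3 / 10 * R i ^ 2 + η / 2) := by
    have e : a / R i * R i ^ 3 * trialEnergy H (a / R i) =
        a * (R i ^ 2 * trialEnergy H (a / R i)) := by field_simp
    rw [e]
    refine mul_le_mul_of_nonneg_left ?_ ha0.le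
    refine (mul_le_mul_of_nonneg_left h3.le (by positivity)).trans ?_
    have h5 : R i ^ 2 ≤ r' ^ 2 + 1 := by nlinarith
    have h6 : R i ^ 2 * (η / (2 * (r' ^ 2 + 1))) ≤ η / 2 := by
      calc R i ^ 2 * (η / (2 * (r' ^ 2 + 1))) ≤ (r' ^ 2 + 1) * (η / (2 * (r' ^ 2 + 1))) := by
            gcongr
        _ = η / 2 := by field_simp
    linarith
  linarith

lemma tendsto_rpow_two_thirds_div (h : ∀ᶠ i in l, 0 < ε i ∧ 0 < κ i ∧ κ i ≤ K ∧ r ≤ R i ∧ R i ≤ r')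
    (hκ : Tendsto (fun i => ε i ^ (1 / 3 : ℝ) / κ i) l (𝓝 0)) :
    Tendsto (fun i => ε i ^ (2 / 3 : ℝ) / κ i ^ 2) l (𝓝 0) := by
  have := hκ.pow 2
  rw [zero_pow two_ne_zero] at this
  refine this.congr' (h.mono fun i hi => ?_)
  rw [div_pow, rpow_one_third_sq hi.1]

/-- Two-sided bounds of the minimal energy, and convergence of the densities of minimizers. -/
lemma eventually_lllMin_bounds (hr : 0 < r)
    (h : ∀ᶠ i in l, 0 < ε i ∧ 0 < κ i ∧ κ i ≤ K ∧ r ≤ R i ∧ R i ≤ r')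
    (hε : Tendsto ε l (𝓝 0)) (hκ : Tendsto (fun i => ε i ^ (1 / 3 : ℝ) / κ i) l (𝓝 0))
    {η : ℝ} (hη : 0 < η) :
    ∀ᶠ i in l, |rescaledMin (ε i) (κ i) (2 / 3 * R i ^ 3) - 3 / 10 * R i ^ 2| ≤ η ∧
      ∀ u, IsLLLMinimizer (ε i) (κ i) (2 / 3 * R i ^ 3) u →
        Integrable (fun x => (‖u x‖ ^ 2 - limitDensity (R i / ε i ^ (2 / 3 : ℝ)) x) ^ 2) ∧
        ∫ x, (‖u x‖ ^ 2 - limitDensity (R i / ε i ^ (2 / 3 : ℝ)) x) ^ 2 ≤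
          ε i ^ (2 / 3 : ℝ) * η := by
  have hπ := Real.pi_pos
  -- The upper and lower errors are each at most aηρ/2. Since ρ ≤ R³/3, dividing their sum by the
  -- coefficient R³/3 leaves at most aη; ρ ≤ 1 takes care of the energy estimate.
  set ρ := min 1 (r ^ 3 / 3) with hρ
  have hρ0 : 0 < ρ := by positivity
  have hθ := tendsto_rpow_two_thirds_div h hκ
  have z1 : Tendsto (fun i => Real.pi ^ 2 * r' ^ 4 * (ε i ^ (2 / 3 : ℝ) / κ i ^ 2) ^ 2) l
      (𝓝 0) := by simpa using (hθ.pow 2).const_mul (Real.pi ^ 2 * r' ^ 4)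
  have z2 : Tendsto (fun i => Real.pi / 4 * r' ^ 4 * (ε i ^ (2 / 3 : ℝ) / κ i ^ 2)) l (𝓝 0) := by
    simpa using hθ.const_mul (Real.pi / 4 * r' ^ 4)
  have hηρ : 0 < η * ρ / 2 := by positivity
  filter_upwards [h, eventually_lllMin_le_of_tendsto hr h hε hηρ,
    z1.eventually_lt_const (by norm_num : (0 : ℝ) < 1 / 4), z2.eventually_lt_const hηρ]
    with i ⟨he, hk, hkK, hr1, hr2⟩ hup h1 h2
  have hR := hr.trans_le hr1
  have ha0 : 0 < ε i ^ (2 / 3 : ℝ) := by positivity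
  have hae := rpow_two_thirds_pow_three he
  rw [rescaledMin]
  set a := ε i ^ (2 / 3 : ℝ) with hadef
  have hsmall : Real.pi ^ 2 * R i ^ 4 * (a / κ i ^ 2) ^ 2 ≤ 1 / 4 := by
    refine le_trans ?_ h1.le
    gcongr
  have herr : Real.pi / 4 * R i ^ 4 * a * (a / κ i ^ 2) ≤ a * (η * ρ / 2) := by
    calc Real.pi / 4 * R i ^ 4 * a * (a / κ i ^ 2)
        ≤ Real.pi / 4 * r' ^ 4 * a * (a / κ i ^ 2) := by gcongr
      _ = a * (Real.pi / 4 * r' ^ 4 * (a / κ i ^ 2)) := by ring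
      _ ≤ _ := mul_le_mul_of_nonneg_left h2.le ha0.le
  have hfin : lllMin (ε i) (κ i) (2 / 3 * R i ^ 3) ≠ ⊤ :=
    ne_top_of_le_ne_top ENNReal.ofReal_ne_top hup
  have hup' : (lllMin (ε i) (κ i) (2 / 3 * R i ^ 3)).toReal ≤
      κ i ^ 2 / (8 * Real.pi) + a * (3 / 10 * R i ^ 2 + η * ρ / 2) :=
    ENNReal.toReal_le_of_le_ofReal (by positivity) hup
  have hlow := (ENNReal.ofReal_le_iff_le_toReal hfin).1 (le_lllMin ha0 hae hk hR hsmall)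
  have hηρ1 : η * ρ / 2 ≤ η := by
    have : η * ρ ≤ η * 1 := mul_le_mul_of_nonneg_left (min_le_left _ _) hη.le
    linarith
  have hq := mul_le_mul_of_nonneg_left hηρ1 ha0.le
  refine ⟨?_, fun u hu => ?_⟩
  · set m := (lllMin (ε i) (κ i) (2 / 3 * R i ^ 3)).toReal
    have e : (m - κ i ^ 2 / (8 * Real.pi)) / a - 3 / 10 * R i ^ 2 =
        (m - κ i ^ 2 / (8 * Real.pi) - 3 / 10 * R i ^ 2 * a) / a := by field_simp
    rw [e, abs_le, le_div_iff₀ ha0, div_le_iff₀ ha0]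
    constructor <;> nlinarith
  · have hE : energy (ε i) (κ i) (2 / 3 * R i ^ 3) u ≠ ⊤ := by rw [hu.2]; exact hfin
    refine ⟨(exists_le_energy ha0 hae hk hR hu.1 hE).1, ?_⟩
    have h3 := le_energy ha0 hae hk hR hsmall hu.1 hE
    rw [hu.2] at h3
    set J := ∫ x, (‖u x‖ ^ 2 - limitDensity (R i / a) x) ^ 2
    have hJ : 0 ≤ J := integral_nonneg fun x => sq_nonneg _
    have h4 : R i ^ 3 / 3 * J ≤ a * (η * ρ) := by nlinarith
    have h5 : ρ ≤ R i ^ 3 / 3 := (min_le_right _ _).trans (by gcongr)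
    have h6 : ρ * J ≤ ρ * (a * η) := by nlinarith [mul_le_mul_of_nonneg_right h5 hJ]
    exact le_of_mul_le_mul_left h6 hρ0

end Asymptotics

/-! ### Convergence of minimizers -/

/-- On [-S, S] use √ρ ≤ (ρ + 1)/2, and ∫ρ = 1. -/
lemma integral_tfProfile_le {S : ℝ} (hS : 0 < S) : ∫ t, tfProfile S t ≤ 1 / 2 + S := by
  have hi : Integrable ((Set.Icc (-S) S).indicator fun _ => (1 / 2 : ℝ)) :=
    (integrableOn_const (by simp)).integrable_indicator measurableSet_Icc
  have h := integral_mono (integrable_tfProfile hS)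
    (((integrable_tfDensity hS).const_mul (1 / 2)).add hi) fun t => by
      simp only [Pi.add_apply, Set.indicator]
      split_ifs with ht
      · have := tfProfile_sq hS t
        nlinarith [sq_nonneg (tfProfile S t - 1)]
      · have ht' : S ≤ |t| := by
          by_contra! h
          exact ht (abs_le.1 h.le)
        rw [tfProfile_eq_zero hS ht', tfDensity_eq_zero hS ht']; simp
  rw [integral_add' ((integrable_tfDensity hS).const_mul _) hi, integral_const_mul,
    integral_tfDensity hS, integral_indicator measurableSet_Icc] at h
  simp at h
  rw [max_eq_left (by positivity)] at h
  linarith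

lemma two_rpow_quarter_sq : ((2 : ℝ) ^ (1 / 4 : ℝ)) ^ 2 = √2 := by
  rw [Real.sqrt_eq_rpow, ← Real.rpow_natCast, ← Real.rpow_mul zero_le_two]; norm_num

lemma limitProfile_sq {S : ℝ} (hS : 0 < S) (x : ℝ × ℝ) :
    limitProfile (tfProfile S) x ^ 2 = limitDensity S x := by
  rw [limitProfile, mul_pow, mul_pow, two_rpow_quarter_sq, tfProfile_sq hS, ← Real.exp_nat_mul,
    limitDensity, gaussWeight]
  have : ((2 : ℕ) : ℝ) * -(Real.pi * x.2 ^ 2) = -(2 * Real.pi * x.2 ^ 2) := by push_cast; ring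
  rw [this]; ring

lemma limitProfile_nonneg {p : ℝ → ℝ} (hp : ∀ t, 0 ≤ p t) (x : ℝ × ℝ) : 0 ≤ limitProfile p x := by
  have := hp x.1
  unfold limitProfile; positivity

lemma continuous_limitProfile {p : ℝ → ℝ} (hp : Continuous p) : Continuous (limitProfile p) := by
  unfold limitProfile; fun_prop

lemma integrable_limitProfile {S : ℝ} (hS : 0 < S) : Integrable (limitProfile (tfProfile S)) := by
  have := (integrable_tfProfile hS).mul_prod
    ((integrable_exp_neg_mul_sq Real.pi_pos).const_mul ((2 : ℝ) ^ (1 / 4 : ℝ)))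
  refine this.congr (.of_forall fun x => ?_)
  simp only [limitProfile, neg_mul]; ring

lemma integral_limitProfile_le {S : ℝ} (hS : 0 < S) :
    ∫ x, limitProfile (tfProfile S) x ≤ 1 + 2 * S := by
  have h := integral_prod_mul (μ := volume) (ν := volume) (tfProfile S)
    (fun y : ℝ => (2 : ℝ) ^ (1 / 4 : ℝ) * Real.exp (-Real.pi * y ^ 2))
  rw [← Measure.volume_eq_prod, integral_const_mul, integral_gaussian, div_self Real.pi_ne_zero,
    Real.sqrt_one, mul_one] at h
  have e : ∫ x, limitProfile (tfProfile S) x =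
      ∫ x : ℝ × ℝ, tfProfile S x.1 * ((2 : ℝ) ^ (1 / 4 : ℝ) * Real.exp (-Real.pi * x.2 ^ 2)) :=
    integral_congr_ae (.of_forall fun x => by simp only [limitProfile, neg_mul]; ring)
  rw [e, h]
  have h2 : (2 : ℝ) ^ (1 / 4 : ℝ) ≤ 2 := by
    simpa using Real.rpow_le_rpow_of_exponent_le one_le_two (by norm_num : (1 / 4 : ℝ) ≤ 1)
  have h3 : 0 ≤ ∫ t, tfProfile S t := integral_nonneg (tfProfile_nonneg S)
  have h4 := integral_tfProfile_le hS
  calc (∫ t, tfProfile S t) * (2 : ℝ) ^ (1 / 4 : ℝ) ≤ (1 / 2 + S) * 2 := by gcongr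
    _ = _ := by ring

lemma integral_limitDensity {S : ℝ} (hS : 0 < S) :
    Integrable (limitDensity S) ∧ ∫ x, limitDensity S x = 1 := by
  have hw : Integrable fun y => √2 * gaussWeight y := by
    unfold gaussWeight
    simpa only [neg_mul] using (integrable_exp_neg_mul_sq
      (mul_pos two_pos Real.pi_pos)).const_mul √2
  have hv : ∫ y, √2 * gaussWeight y = 1 := by
    have := integral_gaussian (2 * Real.pi)
    simp only [gaussWeight]
    simp only [neg_mul] at this
    rw [integral_const_mul, this, ← Real.sqrt_mul zero_le_two,
      show 2 * (Real.pi / (2 * Real.pi)) = 1 by have := Real.pi_ne_zero; field_simp, Real.sqrt_one]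
  refine ⟨(integrable_tfDensity hS).mul_prod hw, ?_⟩
  have h := integral_prod_mul (μ := volume) (ν := volume) (tfDensity S)
    (fun y => √2 * gaussWeight y)
  rw [← Measure.volume_eq_prod, integral_tfDensity hS, hv, mul_one] at h
  exact h

lemma eLpNorm_le_ofReal_of_integral_le {f : ℝ × ℝ → ℝ} {n : ℕ} (hn : n ≠ 0) {e : ℝ} (he : 0 ≤ e)
    (hi : Integrable fun x => ‖f x‖ ^ n) (h : ∫ x, ‖f x‖ ^ n ≤ e ^ n) :
    eLpNorm f n volume ≤ ENNReal.ofReal e := by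
  rw [eLpNorm_eq_lintegral_ofReal_norm_pow _ _ hn,
    ← ofReal_integral_eq_lintegral_ofReal hi (.of_forall fun x => by positivity)]
  calc ENNReal.ofReal (∫ x, ‖f x‖ ^ n) ^ (1 / n : ℝ)
      ≤ ENNReal.ofReal (e ^ n) ^ (1 / n : ℝ) := by gcongr
    _ = ENNReal.ofReal e := by
        rw [ENNReal.ofReal_pow he, ← ENNReal.rpow_natCast, ← ENNReal.rpow_mul,
          mul_one_div_cancel (by exact_mod_cast hn), ENNReal.rpow_one]

/-- Young's inequality used to pass from `L⁴` to `L²` convergence. -/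
lemma mul_le_young_quartic {P k τ : ℝ} (hP : 0 ≤ P) (hτ : 0 < τ) :
    P * k ≤ τ / 2 * P + 1 / (4 * τ ^ 3) * k ^ 4 + τ / 4 * P ^ 2 := by
  have h1 : 0 ≤ P / (2 * τ) * (k - τ) ^ 2 := by positivity
  have h2 : 0 ≤ 1 / (4 * τ ^ 3) * (k ^ 2 - τ ^ 2 * P) ^ 2 := by positivity
  have e : τ / 2 * P + 1 / (4 * τ ^ 3) * k ^ 4 + τ / 4 * P ^ 2 - P * k =
      P / (2 * τ) * (k - τ) ^ 2 + 1 / (4 * τ ^ 3) * (k ^ 2 - τ ^ 2 * P) ^ 2 := by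
    field_simp; ring
  linarith

/-- A state whose density is `L²`-close to the limit density has a rescaled modulus that is close
to the limit profile in `L²` and `L⁴`. -/
lemma eLpNorm_rescaledModulus_sub_le {ε R s : ℝ} (hε : 0 < ε) (hR : 0 < R) {u : ℝ × ℝ → ℂ}
    (hu : u ∈ lllStates)
    (hi : Integrable fun x => (‖u x‖ ^ 2 - limitDensity (R / ε ^ (2 / 3 : ℝ)) x) ^ 2)
    (hs : ∫ x, (‖u x‖ ^ 2 - limitDensity (R / ε ^ (2 / 3 : ℝ)) x) ^ 2 ≤ ε ^ (2 / 3 : ℝ) * s)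
    {e τ : ℝ} (he : 0 ≤ e) (hτ : 0 < τ) (h4 : s ≤ e ^ 4)
    (h2 : τ * (3 / 2 + 2 * R) + s / (2 * τ ^ 3) ≤ e ^ 2) :
    eLpNorm (fun x => rescaledModulus ε u x - limitProfile (tfProfile R) x) 2 volume ≤
      ENNReal.ofReal e ∧
    eLpNorm (fun x => rescaledModulus ε u x - limitProfile (tfProfile R) x) 4 volume ≤
      ENNReal.ofReal e := by
  have ha : 0 < ε ^ (2 / 3 : ℝ) := by positivity
  have hb : (1 / ε ^ (1 / 3 : ℝ)) ^ 2 = (ε ^ (2 / 3 : ℝ))⁻¹ := by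
    rw [div_pow, rpow_one_third_sq hε]; simp
  obtain ⟨cu, -⟩ := exists_entire_of_mem_Lambda0 hu.1
  obtain ⟨iW, hW⟩ := integral_norm_sq_of_mem_lllStates hu
  set a := ε ^ (2 / 3 : ℝ) with hadef
  have ha' : 0 < a⁻¹ := inv_pos.2 ha
  set U := rescaledModulus ε u with hU
  set P := limitProfile (tfProfile R) with hP
  have cU : Continuous U := by
    rw [hU]; unfold rescaledModulus; fun_prop
  have cP : Continuous P := continuous_limitProfile (continuous_tfProfile R)
  have hU0 (x : ℝ × ℝ) : 0 ≤ U x := by rw [hU]; unfold rescaledModulus; positivity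
  have hP0 (x : ℝ × ℝ) : 0 ≤ P x := limitProfile_nonneg (tfProfile_nonneg R) x
  have hUsq (x : ℝ × ℝ) : U x ^ 2 = a⁻¹ * ‖u (a⁻¹ * x.1, x.2)‖ ^ 2 := by
    rw [hU, rescaledModulus, mul_pow, hb, div_eq_inv_mul]
  have hPsq (x : ℝ × ℝ) : P x ^ 2 = limitDensity R x := limitProfile_sq hR x
  have hPsc (x : ℝ × ℝ) : P x ^ 2 = a⁻¹ * limitDensity (R / a) (a⁻¹ * x.1, x.2) := by
    rw [hPsq, limitDensity, limitDensity]
    simp only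
    rw [← div_eq_inv_mul x.1 a, tfDensity_scale hR ha]; field_simp
  have IU : Integrable fun x => U x ^ 2 := by
    simp only [hUsq]; exact (integrable_scaleFst ha' iW).const_mul _
  have IUv : ∫ x, U x ^ 2 = 1 := by
    simp only [hUsq]
    rw [integral_const_mul, integral_scaleFst ha' fun x => ‖u x‖ ^ 2, hW]; field_simp
  have IP : Integrable fun x => P x ^ 2 := by
    simp only [hPsq]; exact (integral_limitDensity hR).1
  have IPv : ∫ x, P x ^ 2 = 1 := by
    simp only [hPsq]; exact (integral_limitDensity hR).2
  -- Each density carries a factor a⁻¹, so the square carries a⁻². The change of variables returns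
  -- one a, and the bound a·s becomes s.
  have hdiff (x : ℝ × ℝ) : (U x ^ 2 - P x ^ 2) ^ 2 = (a⁻¹) ^ 2 *
      (‖u (a⁻¹ * x.1, x.2)‖ ^ 2 - limitDensity (R / a) (a⁻¹ * x.1, x.2)) ^ 2 := by
    rw [hUsq, hPsc]; ring
  have ID : Integrable fun x => (U x ^ 2 - P x ^ 2) ^ 2 := by
    simp only [hdiff]; exact (integrable_scaleFst ha' hi).const_mul _
  have IDv : ∫ x, (U x ^ 2 - P x ^ 2) ^ 2 ≤ s := by
    simp only [hdiff]
    rw [integral_const_mul,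
      integral_scaleFst ha' fun x => (‖u x‖ ^ 2 - limitDensity (R / a) x) ^ 2, inv_inv]
    refine (mul_le_mul_of_nonneg_left (mul_le_mul_of_nonneg_left hs ha.le)
      (by positivity)).trans_eq ?_
    field_simp
  -- For nonnegative numbers |U - P| ≤ U + P, so |U - P|⁴ ≤ (U - P)²(U + P)².
  have h4le (x : ℝ × ℝ) : ‖U x - P x‖ ^ 4 ≤ (U x ^ 2 - P x ^ 2) ^ 2 := by
    have hab : |U x - P x| ≤ U x + P x := by
      rw [abs_le]; constructor <;> linarith [hU0 x, hP0 x]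
    have e1 : (U x ^ 2 - P x ^ 2) ^ 2 = |U x - P x| ^ 2 * (U x + P x) ^ 2 := by
      rw [sq_abs]; ring
    rw [Real.norm_eq_abs, e1, show |U x - P x| ^ 4 = |U x - P x| ^ 2 * |U x - P x| ^ 2 by ring]
    gcongr
  have I4 : Integrable fun x => ‖U x - P x‖ ^ 4 :=
    ID.mono' (Continuous.aestronglyMeasurable (by fun_prop)) (.of_forall fun x => by
      rw [Real.norm_of_nonneg (by positivity)]; exact h4le x)
  have I4v : ∫ x, ‖U x - P x‖ ^ 4 ≤ s := (integral_mono I4 ID h4le).trans IDv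
  have I2 : Integrable fun x => ‖U x - P x‖ ^ 2 :=
    ((IU.add IP).const_mul 2).mono' (Continuous.aestronglyMeasurable (by fun_prop))
      (.of_forall fun x => by
        rw [Real.norm_of_nonneg (by positivity), Real.norm_eq_abs, sq_abs]
        simp only [Pi.add_apply]
        nlinarith [sq_nonneg (U x + P x)])
  have IPi := integrable_limitProfile hR
  have I2v : ∫ x, ‖U x - P x‖ ^ 2 ≤ e ^ 2 := by
    -- Uses (U - P)² = U² - P² + 2P(P - U), whose first two terms cancel after integration. The last
    -- one is controlled by the L⁴ distance together with ∫P and ∫P² through `mul_le_young_quartic`.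
    have hpt (x : ℝ × ℝ) : ‖U x - P x‖ ^ 2 ≤ U x ^ 2 + -(1 * P x ^ 2) + 2 * (τ / 2 * P x +
        1 / (4 * τ ^ 3) * ‖U x - P x‖ ^ 4 + τ / 4 * P x ^ 2) := by
      have hy := mul_le_young_quartic (k := ‖U x - P x‖) (hP0 x) hτ
      have h5 : P x * (P x - U x) ≤ P x * ‖U x - P x‖ := by
        refine mul_le_mul_of_nonneg_left ?_ (hP0 x)
        rw [norm_sub_rev]; exact le_abs_self _
      have e2 : ‖U x - P x‖ ^ 2 = U x ^ 2 + -(1 * P x ^ 2) + 2 * (P x * (P x - U x)) := by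
        rw [Real.norm_eq_abs, sq_abs]; ring
      rw [e2]
      linarith
    have hmono := integral_mono I2 ((IU.add (IP.const_mul 1).neg).add
      ((((IPi.const_mul (τ / 2)).add (I4.const_mul (1 / (4 * τ ^ 3)))).add
        (IP.const_mul (τ / 4))).const_mul 2)) hpt
    rw [integral_add' (IU.add (IP.const_mul 1).neg) ((((IPi.const_mul (τ / 2)).add
        (I4.const_mul (1 / (4 * τ ^ 3)))).add (IP.const_mul (τ / 4))).const_mul 2),
      integral_add' IU (IP.const_mul 1).neg, integral_neg', integral_const_mul, integral_const_mul,
      integral_add' ((IPi.const_mul _).add (I4.const_mul _)) (IP.const_mul _),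
      integral_add' (IPi.const_mul _) (I4.const_mul _), integral_const_mul, integral_const_mul,
      integral_const_mul, IUv, IPv] at hmono
    have b1 := mul_le_mul_of_nonneg_left (integral_limitProfile_le hR)
      (by positivity : 0 ≤ τ / 2)
    have b2 := mul_le_mul_of_nonneg_left I4v (by positivity : 0 ≤ 1 / (4 * τ ^ 3))
    have e3 : s / (2 * τ ^ 3) = 2 * (1 / (4 * τ ^ 3) * s) := by field_simp; norm_num
    rw [e3] at h2
    linarith
  exact ⟨eLpNorm_le_ofReal_of_integral_le two_ne_zero he I2 I2v,
    eLpNorm_le_ofReal_of_integral_le four_ne_zero he I4 (I4v.trans h4)⟩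

lemma tfRadius_mono {g g' : ℝ} (hg : 0 < g) (h : g ≤ g') : tfRadius g ≤ tfRadius g' := by
  unfold tfRadius
  exact Real.rpow_le_rpow (by positivity) (by linarith) (by norm_num)

lemma toReal_min1D {g : ℝ} (hg : 0 < g) : (min1D g).toReal = 3 / 10 * tfRadius g ^ 2 := by
  rw [← tfRadius_spec hg, min1D_eq (tfRadius_pos hg), tfRadius_spec hg]
  exact ENNReal.toReal_ofReal (by positivity)

lemma IsMinimizer1D.ae_eq_tfProfile {g : ℝ} (hg : 0 < g) {p : ℝ → ℝ} (hp0 : ∀ t, 0 ≤ p t)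
    (hp : IsMinimizer1D g p) : p =ᵐ[volume] tfProfile (tfRadius g) := by
  rw [← tfRadius_spec hg] at hp
  filter_upwards [hp.abs_eq (tfRadius_pos hg)] with t ht
  rw [← ht, abs_of_nonneg (hp0 t)]

/-- The asymptotics of the minimal energy and of the minimizers, along any filter along which
`(ε, ε^{1/3} κ⁻¹) → (0, 0)`, `κ` is bounded and the coupling constant stays in a compact subset of
`(0, ∞)`. -/
theorem lllMin_asymptotics {ι : Type*} {l : Filter ι} {ε κ g : ι → ℝ} {K a b : ℝ} (ha : 0 < a)
    (h : ∀ᶠ i in l, 0 < ε i ∧ 0 < κ i ∧ κ i ≤ K ∧ a ≤ g i ∧ g i ≤ b)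
    (hε : Tendsto ε l (𝓝 0)) (hκ : Tendsto (fun i => ε i ^ (1 / 3 : ℝ) / κ i) l (𝓝 0)) :
    Tendsto (fun i => rescaledMin (ε i) (κ i) (g i) - (min1D (g i)).toReal) l (𝓝 0) ∧
      ∀ η : ℝ≥0∞, 0 < η → ∀ᶠ i in l, ∀ p : ℝ → ℝ, (∀ t, 0 ≤ p t) → IsMinimizer1D (g i) p →
        ∀ u : ℝ × ℝ → ℂ, IsLLLMinimizer (ε i) (κ i) (g i) u →
          eLpNorm (fun x => rescaledModulus (ε i) u x - limitProfile p x) 2 volume < η ∧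
          eLpNorm (fun x => rescaledModulus (ε i) u x - limitProfile p x) 4 volume < η := by
  have hr := tfRadius_pos ha
  have hR : ∀ᶠ i in l, 0 < ε i ∧ 0 < κ i ∧ κ i ≤ K ∧ tfRadius a ≤ tfRadius (g i) ∧
      tfRadius (g i) ≤ tfRadius b := by
    filter_upwards [h] with i ⟨h1, h2, h3, h4, h5⟩
    exact ⟨h1, h2, h3, tfRadius_mono ha h4, tfRadius_mono (ha.trans_le h4) h5⟩
  refine ⟨Metric.tendsto_nhds.2 fun η hη => ?_, fun η hη => ?_⟩
  · filter_upwards [h, eventually_lllMin_bounds hr hR hε hκ (half_pos hη)]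
      with i ⟨_, _, _, hg, _⟩ hi
    have hg := ha.trans_le hg
    rw [tfRadius_spec hg] at hi
    rw [dist_zero_right, Real.norm_eq_abs, toReal_min1D hg]
    linarith [hi.1]
  · obtain ⟨e, he, heη⟩ : ∃ e : ℝ, 0 < e ∧ ENNReal.ofReal e < η := by
      obtain ⟨e, -, h1, h2⟩ := ENNReal.lt_iff_exists_real_btwn.1 hη
      exact ⟨e, ENNReal.ofReal_pos.1 h1, h2⟩
    set r' := tfRadius b
    -- The sign of b is not known, since the eventual bounds may hold vacuously; the absolute value
    -- keeps this constant positive. Then τ and s are chosen so that each of the two errors in the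
    -- L² estimate is at most e²/2.
    have hC : 0 < 3 / 2 + 2 * |r'| := by positivity
    set τ := e ^ 2 / (2 * (3 / 2 + 2 * |r'|)) with hτdef
    have hτ : 0 < τ := by positivity
    set s := min (e ^ 4) (e ^ 2 * τ ^ 3) with hsdef
    have hs : 0 < s := by positivity
    filter_upwards [h, hR, eventually_lllMin_bounds hr hR hε hκ hs]
      with i ⟨he0, _, _, hg, _⟩ ⟨_, _, _, _, hr2⟩ hi p hp0 hp u hu
    have hg := ha.trans_le hg
    rw [tfRadius_spec hg] at hi
    obtain ⟨hi1, hi2⟩ := hi.2 u hu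
    have h2 : τ * (3 / 2 + 2 * tfRadius (g i)) + s / (2 * τ ^ 3) ≤ e ^ 2 := by
      have b1 : τ * (3 / 2 + 2 * tfRadius (g i)) ≤ τ * (3 / 2 + 2 * |r'|) := by
        gcongr
        exact hr2.trans (le_abs_self _)
      have b2 : τ * (3 / 2 + 2 * |r'|) = e ^ 2 / 2 := by rw [hτdef]; field_simp
      have b3 : s / (2 * τ ^ 3) ≤ e ^ 2 / 2 := by
        rw [div_le_iff₀ (by positivity)]
        refine (min_le_right _ _).trans_eq ?_
        ring
      linarith
    obtain ⟨c2, c4⟩ := eLpNorm_rescaledModulus_sub_le he0 (tfRadius_pos hg) hu.1 hi1 hi2 he.le hτ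
      (min_le_left _ _) h2
    have hpx : (fun x => rescaledModulus (ε i) u x - limitProfile p x) =ᵐ[volume]
        fun x => rescaledModulus (ε i) u x - limitProfile (tfProfile (tfRadius (g i))) x := by
      have := (Measure.quasiMeasurePreserving_fst (μ := (volume : Measure ℝ))
        (ν := (volume : Measure ℝ))).ae (hp.ae_eq_tfProfile hg hp0)
      rw [← Measure.volume_eq_prod] at this
      filter_upwards [this] with x hx
      simp only [limitProfile, hx]
    rw [eLpNorm_congr_ae hpx, eLpNorm_congr_ae hpx]
    exact ⟨c2.trans_lt heη, c4.trans_lt heη⟩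

/-! ### The physical parameters -/

/-- Along the physical parameters, `κ` and `g₀` stay in compact sets. -/
lemma exists_physical_bounds {g ω₀ : ℝ} (hg : 0 < g) (hω₀ : 0 < ω₀) :
    ∃ K a b : ℝ, 0 < a ∧ ∀ ω ν ε : ℝ, ω₀ ≤ ω → 0 < ν → 0 < ε → ω ^ 2 + ν ^ 2 + ε ^ 2 = 1 →
      0 < kappa ω ν ε ∧ kappa ω ν ε ≤ K ∧ a ≤ g0 g ω ν ∧ g0 g ω ν ≤ b := by
  refine ⟨√(3 * (1 + 2 / (2 * ω₀ ^ 2))) / (2 * ω₀ / 6), g / 2 * 4 ^ 2 / (4 * (6 / (2 * ω₀))),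
    g * (6 / (4 * ω₀)) * (6 / ω₀) ^ 2 / (4 * (2 * ω₀ / 6)), by positivity,
    fun ω ν ε hω hν hε hsum => ?_⟩
  have hω0 : 0 < ω := hω₀.trans_le hω
  have hω1 : ω ^ 2 ≤ 1 := by nlinarith [sq_nonneg ν, sq_nonneg ε]
  have hν1 : ν ^ 2 ≤ 1 := by nlinarith [sq_nonneg ω, sq_nonneg ε]
  have hε1 : ε ^ 2 ≤ 1 := by nlinarith [sq_nonneg ω, sq_nonneg ν]
  have hω1' : ω ≤ 1 := by nlinarith
  have hν4 : ν ^ 4 ≤ 1 := by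
    rw [show ν ^ 4 = (ν ^ 2) ^ 2 by ring]; exact pow_le_one₀ (by positivity) hν1
  -- The lower bounds by 2ω and by ν² keep every denominator away from 0: the first serves β₂ and
  -- g₁, the second the denominator α - ν² + 2ω² in κ₁.
  have hα1 : 2 * ω ≤ alpha ω ν := Real.le_sqrt_of_sq_le (by nlinarith [pow_pos hν 4])
  have hα2 : ν ^ 2 ≤ alpha ω ν := Real.le_sqrt_of_sq_le (by nlinarith)
  have hα3 : alpha ω ν ≤ 3 := Real.sqrt_le_iff.2 ⟨by norm_num, by nlinarith⟩
  have hα0 : 0 < alpha ω ν := by linarith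
  have hμ1 : 1 ≤ mu2 ω ν := Real.one_le_sqrt.2 (by nlinarith)
  have hμ2 : mu2 ω ν ≤ 3 := Real.sqrt_le_iff.2 ⟨by norm_num, by nlinarith⟩
  have hD1 : 2 * ω ≤ alpha ω ν + 2 * ω ^ 2 + ν ^ 2 := by nlinarith [sq_nonneg ω, sq_nonneg ν]
  have hD2 : alpha ω ν + 2 * ω ^ 2 + ν ^ 2 ≤ 6 := by linarith
  have hD0 : 0 < alpha ω ν + 2 * ω ^ 2 + ν ^ 2 := by linarith
  have hβ1 : 2 * ω₀ / 6 ≤ beta2 ω ν := by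
    unfold beta2
    refine div_le_div₀ (by positivity) ?_ hD0 hD2
    nlinarith
  have hβ2 : beta2 ω ν ≤ 6 / (2 * ω₀) := by
    unfold beta2
    refine div_le_div₀ (by norm_num) ?_ (by positivity) (by linarith)
    nlinarith
  have hβ0 : 0 < beta2 ω ν := lt_of_lt_of_le (by positivity) hβ1
  have hγ1 : 4 ≤ gam ω ν := by
    unfold gam
    rw [le_div_iff₀ hω0]; linarith
  have hγ2 : gam ω ν ≤ 6 / ω₀ := by
    unfold gam
    exact div_le_div₀ (by norm_num) (by linarith) hω₀ hω
  have hE1 : 2 * ω₀ ^ 2 ≤ alpha ω ν - ν ^ 2 + 2 * ω ^ 2 := by nlinarith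
  have hE0 : 0 < alpha ω ν - ν ^ 2 + 2 * ω ^ 2 := lt_of_lt_of_le (by positivity) hE1
  have hκ0 : 0 < kappa1 ω ν ε := Real.sqrt_pos.2 (by positivity)
  have hκ1 : kappa1 ω ν ε ≤ √(3 * (1 + 2 / (2 * ω₀ ^ 2))) := by
    unfold kappa1
    refine Real.sqrt_le_sqrt (mul_le_mul (by linarith) ?_ (by positivity) (by norm_num))
    gcongr
    linarith
  have hg1 : g / 2 ≤ g1 g ω ν := by
    unfold g1
    rw [div_eq_mul_inv]
    refine mul_le_mul_of_nonneg_left ?_ hg.le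
    rw [le_div_iff₀ (by positivity)]
    nlinarith [sq_nonneg ω, sq_nonneg ν]
  have hg2 : g1 g ω ν ≤ g * (6 / (4 * ω₀)) := by
    unfold g1
    refine mul_le_mul_of_nonneg_left ?_ hg.le
    exact div_le_div₀ (by norm_num) hD2 (by positivity) (by linarith)
  have hg0 : 0 < g1 g ω ν := lt_of_lt_of_le (by positivity) hg1
  refine ⟨div_pos hκ0 hβ0, ?_, ?_, ?_⟩
  · exact div_le_div₀ (by positivity) hκ1 (by positivity) hβ1
  · unfold g0
    gcongr
  · unfold g0
    gcongr

end AnisotropicBEC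

theorem theorem1p2 :
    -- `J` is attained by a nonnegative function, and every minimizer has this modulus
    (∀ g₀ : ℝ, 0 < g₀ → ∃ p : ℝ → ℝ, (∀ t, 0 ≤ p t) ∧ IsMinimizer1D g₀ p ∧
      ∀ q : ℝ → ℝ, IsMinimizer1D g₀ q → (fun t => |q t|) =ᵐ[volume] p) ∧
    -- `(ε, κ)` as free parameters, with `g₀` fixed and `κ` bounded
    (∀ g₀ K : ℝ, 0 < g₀ → 0 < K →
      Tendsto (fun q : ℝ × ℝ => rescaledMin q.1 q.2 g₀) (strongRegime K)
        (𝓝 (min1D g₀).toReal) ∧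
      ∀ p : ℝ → ℝ, (∀ t, 0 ≤ p t) → IsMinimizer1D g₀ p →
        ∀ η : ℝ≥0∞, 0 < η → ∀ᶠ q : ℝ × ℝ in strongRegime K,
          ∀ u : ℝ × ℝ → ℂ, IsLLLMinimizer q.1 q.2 g₀ u →
            eLpNorm (fun x => rescaledModulus q.1 u x - limitProfile p x) 2 volume < η ∧
            eLpNorm (fun x => rescaledModulus q.1 u x - limitProfile p x) 4 volume < η) ∧
    -- `κ` and `g₀` as functions of the physical parameters `P = (ω, ν, ε)` and `g`
    (∀ g ω₀ : ℝ, 0 < g → 0 < ω₀ →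
      Tendsto (fun P : ℝ × ℝ × ℝ =>
          rescaledMin P.2.2 (kappa P.1 P.2.1 P.2.2) (g0 g P.1 P.2.1) -
            (min1D (g0 g P.1 P.2.1)).toReal)
        (physicalRegime ω₀) (𝓝 0) ∧
      ∀ η : ℝ≥0∞, 0 < η → ∀ᶠ P : ℝ × ℝ × ℝ in physicalRegime ω₀,
        ∀ p : ℝ → ℝ, (∀ t, 0 ≤ p t) → IsMinimizer1D (g0 g P.1 P.2.1) p →
          ∀ u : ℝ × ℝ → ℂ,
            IsLLLMinimizer P.2.2 (kappa P.1 P.2.1 P.2.2) (g0 g P.1 P.2.1) u →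
            eLpNorm (fun x => rescaledModulus P.2.2 u x - limitProfile p x) 2 volume < η ∧
            eLpNorm (fun x => rescaledModulus P.2.2 u x - limitProfile p x) 4 volume < η) := by
  refine ⟨fun g₀ hg => ?_, fun g₀ K hg hK => ?_, fun g ω₀ hg hω₀ => ?_⟩
  · have hR := tfRadius_pos hg
    rw [← tfRadius_spec hg]
    exact ⟨tfProfile (tfRadius g₀), tfProfile_nonneg _, isMinimizer1D_tfProfile hR,
      fun q hq => hq.abs_eq hR⟩
  · have hlim : Tendsto (fun q : ℝ × ℝ => (q.1, q.1 ^ (1 / 3 : ℝ) / q.2)) (strongRegime K)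
        (𝓝 (0, 0)) := tendsto_comap.mono_left inf_le_left
    have hmem : ∀ᶠ q : ℝ × ℝ in strongRegime K, 0 < q.1 ∧ 0 < q.2 ∧ q.2 ≤ K :=
      mem_inf_of_right (mem_principal_self _)
    -- A constant coupling: the compact range is the single point g₀.
    obtain ⟨h1, h2⟩ := lllMin_asymptotics (g := fun _ => g₀) hg
      (hmem.mono fun q hq => ⟨hq.1, hq.2.1, hq.2.2, le_rfl, le_rfl⟩)
      ((continuous_fst.tendsto _).comp hlim) ((continuous_snd.tendsto _).comp hlim)
    refine ⟨by simpa using h1.add_const (min1D g₀).toReal, fun p hp0 hp η hη => ?_⟩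
    filter_upwards [h2 η hη] with q hq
    exact hq p hp0 hp
  · have hlim : Tendsto (fun P : ℝ × ℝ × ℝ =>
        (P.2.2, P.2.2 ^ (1 / 3 : ℝ) / kappa P.1 P.2.1 P.2.2)) (physicalRegime ω₀)
        (𝓝 (0, 0)) := tendsto_comap.mono_left inf_le_left
    have hmem : ∀ᶠ P : ℝ × ℝ × ℝ in physicalRegime ω₀,
        ω₀ ≤ P.1 ∧ 0 < P.2.1 ∧ 0 < P.2.2 ∧ P.1 ^ 2 + P.2.1 ^ 2 + P.2.2 ^ 2 = 1 :=
      mem_inf_of_right (mem_principal_self _)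
    obtain ⟨K, a, b, ha, hb⟩ := exists_physical_bounds hg hω₀
    exact lllMin_asymptotics ha
      (hmem.mono fun P hP => ⟨hP.2.2.1, hb _ _ _ hP.1 hP.2.1 hP.2.2.1 hP.2.2.2⟩)
      ((continuous_fst.tendsto _).comp hlim) ((continuous_snd.tendsto _).comp hlim)
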